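/- All graphs are finite and simple. A graph $G$ is $\mathscr F$-free, for a family $\mathscr F$ of graphs, if no member of $\mathscr F$ is a (not necessarily induced) subgraph of $G$. Let $ex(n,\mathscr F)$ be the maximum number of edges of an $\mathscr F$-free graph on $n$ vertices, with the convention $ex(n,\mathscr F)=-\infty$ if there is no $\mathscr F$-free graph on $n$ vertices. Let $P_\ell$ be the path on $\ell$ vertices and $kP_\ell$ the disjoint union of $k$ copies of $P_\ell$. An edge control set of a graph $F$ is a set $E'\subseteq E(F)$ such that every edge in $E(F)\setminus E'$ shares an endpoint with some edge in $E'$; $\beta_1(F)$ is the minimum size of an edge control set of $F$. Put $$\mathscr G_1(F)=\{F[V(F)\setminus S] : S\subseteq V(F),\ e(F[S])=0\},\qquad \mathscr G_2(F)=\{F[V(F)\setminus S] : S\subseteq V(F),\ e(F[S])\le 1\}.$$ **Theorem.** Let $F$ be a graph of order $r\ge 3$ with $\chi(F)\ge 3$ and $\beta_1(F)\ge 2$. Let $k\ge 2$, $\ell\ge 4$ and $$n\ \ge\ 4k^2\ell^2(k\ell+r)\left(\left\lfloor\tfrac{\ell}{2}\right\rfloor+1\right)\binom{\ell}{\lfloor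 \ell/2\rfloor}.$$ Then $$ex(n,\{F,kP_\ell\})=\left(n-k\left\lfloor\tfrac{\ell}{2}\right\rfloor+1\right)\left(k\left\lfloor\tfrac{\ell}{2}\right\rfloor-1\right)+b_\ell,$$ where $b_\ell=ex\left(k\lfloor\frac{\ell}{2}\rfloor-1,\mathscr G_1(F)\right)$ if $\ell$ is even, and $b_\ell=\max\left\{1+ex\left(k\lfloor\frac{\ell}{2}\rfloor-1,\mathscr G_2(F)\right),\ ex\left(k\lfloor\frac{\ell}{2}\rfloor-1,\mathscr G_1(F)\right)\right\}$ if $\ell$ is odd. -/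

import Mathlib

/-- A family of graphs. -/
abbrev GraphFamily : Type 1 := Set (Σ W : Type, SimpleGraph W)

/-- `G` is `𝓕`-free: no member of `𝓕` is contained in `G` as a (not necessarily induced)
subgraph. -/
def FamilyFree {U : Type} (𝓕 : GraphFamily) (G : SimpleGraph U) : Prop :=
  ∀ H ∈ 𝓕, H.2.Free G

open Classical in
/-- The Turán number `ex(n, 𝓕)`: the maximum number of edges of an `𝓕`-free graph on `n`
vertices. It takes values in `ℕ ∪ {-∞}`; the value is `⊥ = -∞` (the maximum of the empty set)
exactly when there is no `𝓕`-free graph on `n` vertices. -/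
noncomputable def turanNumber (n : ℕ) (𝓕 : GraphFamily) : WithBot ℕ :=
  (Finset.univ.filter fun G : SimpleGraph (Fin n) => FamilyFree 𝓕 G).sup
    fun G => (G.edgeSet.ncard : WithBot ℕ)

/-- `k H`: the disjoint union of `k` copies of `H`. -/
def disjointCopies {W : Type} (k : ℕ) (H : SimpleGraph W) : SimpleGraph (Fin k × W) where
  Adj p q := p.1 = q.1 ∧ H.Adj p.2 q.2
  symm := ⟨fun _ _ h => ⟨h.1.symm, h.2.symm⟩⟩
  loopless := ⟨fun _ h => h.2.ne rfl⟩

/-- `E'` is an edge control set of `F`: a set of edges of `F` such that every other edge of `F`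
shares an endpoint with some member of `E'`. -/
def IsEdgeControlSet {V : Type} (F : SimpleGraph V) (E' : Set (Sym2 V)) : Prop :=
  E' ⊆ F.edgeSet ∧ ∀ e ∈ F.edgeSet \ E', ∃ e' ∈ E', ∃ v, v ∈ e ∧ v ∈ e'

/-- The edge control number `β₁(F)` of a finite graph: the minimum size of an edge control set
(the set of all edges is one, so the infimum is over a nonempty set). -/
noncomputable def edgeControlNumber {V : Type} (F : SimpleGraph V) : ℕ :=
  sInf {s | ∃ E' : Set (Sym2 V), IsEdgeControlSet F E' ∧ E'.ncard = s}

/-- `𝒢₁(F)`: all graphs `F[V(F) ∖ S]`, where `S ⊆ V(F)` and `F[S]` has no edge. -/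
def familyG₁ {V : Type} (F : SimpleGraph V) : GraphFamily :=
  {H | ∃ S : Set V, (F.induce S).edgeSet.ncard = 0 ∧ H = ⟨↥(Sᶜ), F.induce Sᶜ⟩}

/-- `𝒢₂(F)`: all graphs `F[V(F) ∖ S]`, where `S ⊆ V(F)` and `F[S]` has at most one edge. -/
def familyG₂ {V : Type} (F : SimpleGraph V) : GraphFamily :=
  {H | ∃ S : Set V, (F.induce S).edgeSet.ncard ≤ 1 ∧ H = ⟨↥(Sᶜ), F.induce Sᶜ⟩}

open Classical in
/-- The constant `b_ℓ`, with `m = k⌊ℓ/2⌋ - 1`: it is `max {1 + ex(m, 𝒢₂(F)), ex(m, 𝒢₁(F))}` for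
odd `ℓ` and `ex(m, 𝒢₁(F))` for even `ℓ`. -/
noncomputable def bConst {V : Type} (F : SimpleGraph V) (k ℓ : ℕ) : WithBot ℕ :=
  if Odd ℓ then
    max (1 + turanNumber (k * (ℓ / 2) - 1) (familyG₂ F))
      (turanNumber (k * (ℓ / 2) - 1) (familyG₁ F))
  else turanNumber (k * (ℓ / 2) - 1) (familyG₁ F)

set_option linter.unusedSectionVars false

/-! Write h = ⌊ℓ/2⌋ and m = kh - 1.

Lower bound. Join a graph H on m vertices to n - m vertices spanning no edge, or a single edge when
ℓ is odd. Every copy of P_ℓ has at least h vertices in H, so k disjoint copies need kh > m of them.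
In a copy of F, let S be the set of vertices outside H. Then F[S] has no edge (at most one edge) and
H contains F - S, so a 𝒢₁-free (𝒢₂-free) H makes the join F-free (`free_joinGraph`,
`formula_le_turanNumber`).

Upper bound. Since χ(F) ≥ 3, the constant b_ℓ is nonnegative, so G may be assumed to have more than
(n - m)m edges. Such density forces m vertices A with a large set J of common neighbours
(`exists_core`). To find A, remove h vertices at a time, each removal lowering by one the number of
disjoint paths that must be excluded, until (k-1)h vertices W are gone and the rest X has no path on
2h+1 vertices. The other h - 1 vertices of A are then found in X, because too many disjoint 3-vertex
paths with ends in the common neighbourhood of W would again produce k paths.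

Given A and J, a path on ℓ vertices with at most h - 1 vertices in A would leave enough of A and J
for k - 1 further paths. Hence hardly any edges lie outside A, and `cnt_le_of_core` bounds e(G) by
e(A) + m(n - m) + e(J), where e(J) ≤ 1, and e(J) = 0 for even ℓ. As J has room for any S, e(A) is at
most ex(m, 𝒢₁), and at most ex(m, 𝒢₂) if J spans an edge (`cnt_le_turanNumber`).

The recurring estimate is the Erdős–Gallai theorem, sharpened in `cnt_add_card_le` by a saving for
vertices that start no 2h-vertex path. Edges are counted as ordered pairs, so `cnt G X X` is twice
the number of edges inside X. -/

namespace PathTuran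

/-! ### Paths as vertex lists -/

section Basic

variable {V : Type*} {G : SimpleGraph V}

/-- `l` lists the vertices of a path of `G` all of whose vertices lie in `X`. -/
structure IsPathIn (G : SimpleGraph V) (X : Finset V) (l : List V) : Prop where
  chain : l.IsChain G.Adj
  nodup : l.Nodup
  mem : ∀ x ∈ l, x ∈ X

lemma IsPathIn.mono {X Y : Finset V} {l : List V} (h : IsPathIn G X l) (hXY : X ⊆ Y) :
    IsPathIn G Y l := ⟨h.chain, h.nodup, fun x hx => hXY (h.mem x hx)⟩

lemma IsPathIn.reverse {X : Finset V} {l : List V} (h : IsPathIn G X l) :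
    IsPathIn G X l.reverse :=
  ⟨by rw [List.isChain_reverse]; exact h.chain.imp fun _ _ h => h.symm,
    List.nodup_reverse.2 h.nodup, fun x hx => h.mem x (List.mem_reverse.1 hx)⟩

lemma IsPathIn.take {X : Finset V} {l : List V} (h : IsPathIn G X l) (n : ℕ) :
    IsPathIn G X (l.take n) :=
  ⟨h.chain.take n, h.nodup.sublist (List.take_sublist n l),
    fun x hx => h.mem x (List.mem_of_mem_take hx)⟩

lemma IsPathIn.cons {X : Finset V} {l : List V} (h : IsPathIn G X l) {y : V} (hy : y ∈ X)
    (hyl : y ∉ l) (hadj : ∀ x ∈ l.head?, G.Adj y x) : IsPathIn G X (y :: l) :=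
  ⟨List.isChain_cons.2 ⟨hadj, h.chain⟩, List.nodup_cons.2 ⟨hyl, h.nodup⟩, by
    intro x hx
    rcases List.mem_cons.1 hx with rfl | hx
    · exact hy
    · exact h.mem x hx⟩

lemma IsPathIn.length_le [DecidableEq V] {X : Finset V} {l : List V} (h : IsPathIn G X l) :
    l.length ≤ X.card := by
  rw [← List.toFinset_card_of_nodup h.nodup]
  exact Finset.card_le_card fun x hx => h.mem x (List.mem_toFinset.1 hx)

end Basic

/-! ### Counting ordered adjacent pairs -/

section Count

variable {V : Type*} [DecidableEq V] (G : SimpleGraph V) [DecidableRel G.Adj]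

/-- The number of neighbours of `x` in `Y`. -/
def degIn (Y : Finset V) (x : V) : ℕ := (Y.filter (G.Adj x)).card

/-- The number of pairs of adjacent vertices, the first in `X` and the second in `Y`. -/
def cnt (X Y : Finset V) : ℕ := ∑ x ∈ X, degIn G Y x

variable {G}

lemma degIn_le_card (Y : Finset V) (x : V) : degIn G Y x ≤ Y.card := Finset.card_filter_le _ _

lemma degIn_mono {Y Z : Finset V} (h : Y ⊆ Z) (x : V) : degIn G Y x ≤ degIn G Z x :=
  Finset.card_le_card (Finset.filter_subset_filter _ h)

lemma degIn_pos {Y : Finset V} {x : V} : 0 < degIn G Y x ↔ ∃ y ∈ Y, G.Adj x y := by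
  simp [degIn, Finset.card_pos, Finset.Nonempty]

lemma degIn_eq_zero {Y : Finset V} {x : V} : degIn G Y x = 0 ↔ ∀ y ∈ Y, ¬ G.Adj x y := by
  rw [← not_iff_not, ← Ne, ← Nat.pos_iff_ne_zero, degIn_pos]; push Not; rfl

lemma degIn_eq_card {Y : Finset V} {x : V} : degIn G Y x = Y.card ↔ ∀ y ∈ Y, G.Adj x y := by
  simp [degIn, Finset.card_filter_eq_iff]

lemma degIn_le_one {Y : Finset V} {x : V} :
    degIn G Y x ≤ 1 ↔ ∀ y ∈ Y, ∀ z ∈ Y, G.Adj x y → G.Adj x z → y = z := by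
  simp only [degIn, Finset.card_le_one, Finset.mem_filter]
  grind

lemma cnt_comm (X Y : Finset V) : cnt G X Y = cnt G Y X := by
  simp only [cnt, degIn, Finset.card_filter]
  rw [Finset.sum_comm]
  simp only [G.adj_comm]

lemma cnt_union_left {X Y : Finset V} (h : Disjoint X Y) (Z : Finset V) :
    cnt G (X ∪ Y) Z = cnt G X Z + cnt G Y Z := Finset.sum_union h

lemma cnt_union_right {Y Z : Finset V} (h : Disjoint Y Z) (X : Finset V) :
    cnt G X (Y ∪ Z) = cnt G X Y + cnt G X Z := by
  rw [cnt_comm, cnt_union_left h, cnt_comm Y, cnt_comm Z]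

lemma cnt_union_self {X Y : Finset V} (h : Disjoint X Y) :
    cnt G (X ∪ Y) (X ∪ Y) = cnt G X X + 2 * cnt G X Y + cnt G Y Y := by
  rw [cnt_union_left h, cnt_union_right h, cnt_union_right h, cnt_comm Y X]; ring

lemma cnt_split {X Y : Finset V} (h : Y ⊆ X) :
    cnt G X X = cnt G Y Y + 2 * cnt G Y (X \ Y) + cnt G (X \ Y) (X \ Y) := by
  rw [← cnt_union_self Finset.disjoint_sdiff, Finset.union_sdiff_of_subset h]

lemma cnt_le_mul {X Y : Finset V} {c : ℕ} (h : ∀ x ∈ X, degIn G Y x ≤ c) :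
    cnt G X Y ≤ X.card * c := by
  simpa [cnt] using Finset.sum_le_card_nsmul X _ c h

lemma cnt_le_card_mul (X Y : Finset V) : cnt G X Y ≤ X.card * Y.card :=
  cnt_le_mul fun x _ => degIn_le_card Y x

lemma cnt_self_le (X : Finset V) : cnt G X X ≤ X.card * (X.card - 1) := by
  refine cnt_le_mul fun x hx => ?_
  rw [← Finset.card_erase_of_mem hx]
  refine Finset.card_le_card fun y hy => ?_
  rw [Finset.mem_filter] at hy
  exact Finset.mem_erase.2 ⟨hy.2.ne', hy.1⟩

lemma cnt_erase {X : Finset V} {v : V} (hv : v ∈ X) :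
    cnt G X X = cnt G (X.erase v) (X.erase v) + 2 * degIn G X v := by
  have h := cnt_split (G := G) (Finset.singleton_subset_iff.2 hv)
  rw [Finset.sdiff_singleton_eq_erase] at h
  have h1 : degIn G X v = degIn G (X.erase v) v := by
    unfold degIn; congr 1; ext y
    simp only [Finset.mem_filter, Finset.mem_erase]
    exact ⟨fun h => ⟨⟨h.2.ne', h.1⟩, h.2⟩, fun h => ⟨h.1.2, h.2⟩⟩
  have h2 := cnt_self_le (G := G) {v}
  simp at h2
  have h3 : cnt G {v} (X.erase v) = degIn G (X.erase v) v := by simp [cnt]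
  rw [h, h1, h2, h3]; ring

end Count

/-! ### A refined Erdős–Gallai theorem -/

section Dirac

variable {V : Type*} [DecidableEq V] {G : SimpleGraph V} [DecidableRel G.Adj]

lemma exists_longest_path (G : SimpleGraph V) {X : Finset V} (hX : X.Nonempty) :
    ∃ l, IsPathIn G X l ∧ l ≠ [] ∧ ∀ l', IsPathIn G X l' → l'.length ≤ l.length := by
  classical
  obtain ⟨x, hx⟩ := hX
  let P : ℕ → Prop := fun t => ∃ l, IsPathIn G X l ∧ l.length = t
  have h1 : P 1 := ⟨[x], ⟨by simp, by simp, by simpa using hx⟩, rfl⟩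
  have hb : ∀ t, P t → t ≤ X.card := fun t ⟨l, hl, ht⟩ => ht ▸ hl.length_le
  obtain ⟨l, hl, hlen⟩ : P (Nat.findGreatest P X.card) := Nat.findGreatest_spec (hb 1 h1) h1
  have h2 : 1 ≤ Nat.findGreatest P X.card := Nat.le_findGreatest (hb 1 h1) h1
  refine ⟨l, hl, ?_, fun l' hl' => ?_⟩
  · rintro rfl; simp at hlen; omega
  · rw [hlen]; exact Nat.le_findGreatest hl'.length_le ⟨l', hl', rfl⟩

/-- A longest path of length at most `2h` whose end vertices have degree at least `h` can be
rearranged into a cycle on the same vertices. -/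
lemma exists_cycle_of_longest {X : Finset V} {h : ℕ} (hdeg : ∀ v ∈ X, h ≤ degIn G X v)
    {l : List V} (hl : IsPathIn G X l) (hne : l ≠ [])
    (hmax : ∀ l', IsPathIn G X l' → l'.length ≤ l.length) (_hh : 1 ≤ h) (hlen : l.length ≤ 2 * h) :
    ∃ c, IsPathIn G X c ∧ c.length = l.length ∧ (∀ x, x ∈ c ↔ x ∈ l) ∧
      ∀ x ∈ c.getLast?, ∀ y ∈ c.head?, G.Adj x y := by
  have hpos : 0 < l.length := List.length_pos_iff.2 hne
  have hhead : ∀ y ∈ X, G.Adj (l[0]) y → y ∈ l := by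
    intro y hy hadj
    by_contra hyl
    have := hmax _ (hl.cons hy hyl (by
      intro x hx
      rw [List.head?_eq_getElem?, List.getElem?_eq_getElem hpos] at hx
      simp at hx; subst hx; exact hadj.symm))
    simp at this
  have hlast : ∀ y ∈ X, G.Adj (l[l.length - 1]) y → y ∈ l := by
    intro y hy hadj
    by_contra hyl
    have := hmax _ (hl.reverse.cons hy (by simpa using hyl) (by
      intro x hx
      rw [List.head?_reverse, List.getLast?_eq_getElem?, List.getElem?_eq_getElem (by omega)] at hx
      simp at hx; subst hx; exact hadj.symm))
    simp at this
  let p := l.length - 1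
  let f : ℕ → V := fun i => l.getD i (l[0])
  have hf : ∀ i (hi : i < l.length), f i = l[i] := fun i hi => by simp [f, hi]
  let S1 := (Finset.range p).filter fun i => G.Adj (f 0) (f (i + 1))
  let S2 := (Finset.range p).filter fun i => G.Adj (f p) (f i)
  have hS1 : h ≤ S1.card := by
    refine (hdeg (l[0]) (hl.mem _ (List.getElem_mem _))).trans ?_
    refine (Finset.card_le_card (t := S1.image fun i => f (i + 1)) ?_).trans Finset.card_image_le
    intro y hy
    rw [Finset.mem_filter] at hy
    obtain ⟨i, hi, rfl⟩ := List.getElem_of_mem (hhead y hy.1 hy.2)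
    have hi0 : i ≠ 0 := by rintro rfl; exact hy.2.ne rfl
    refine Finset.mem_image.2 ⟨i - 1, ?_, ?_⟩
    · refine Finset.mem_filter.2 ⟨Finset.mem_range.2 (by omega), ?_⟩
      rw [hf 0 hpos, Nat.sub_add_cancel (by omega), hf i hi]; exact hy.2
    · rw [Nat.sub_add_cancel (by omega), hf i hi]
  have hS2 : h ≤ S2.card := by
    refine (hdeg (l[l.length - 1]) (hl.mem _ (List.getElem_mem _))).trans ?_
    refine (Finset.card_le_card (t := S2.image f) ?_).trans Finset.card_image_le
    intro y hy
    rw [Finset.mem_filter] at hy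
    obtain ⟨i, hi, rfl⟩ := List.getElem_of_mem (hlast y hy.1 hy.2)
    have hi0 : i ≠ l.length - 1 := by rintro rfl; exact hy.2.ne rfl
    refine Finset.mem_image.2 ⟨i, ?_, hf i hi⟩
    refine Finset.mem_filter.2 ⟨Finset.mem_range.2 (by omega), ?_⟩
    rw [hf p (by omega), hf i hi]; exact hy.2
  -- Both index sets have at least h elements among p ≤ 2h - 1 indices, so they meet.
  have hinter : (S1 ∩ S2).Nonempty := by
    rw [← Finset.card_pos]
    have h1 := Finset.card_union_add_card_inter S1 S2
    have h2 : (S1 ∪ S2).card ≤ p := by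
      rw [← Finset.card_range p]
      exact Finset.card_le_card (Finset.union_subset (Finset.filter_subset _ _)
        (Finset.filter_subset _ _))
    omega
  obtain ⟨i, hi⟩ := hinter
  simp only [S1, S2, Finset.mem_inter, Finset.mem_filter, Finset.mem_range] at hi
  obtain ⟨⟨hip, h1⟩, -, h2⟩ := hi
  have hpl : p < l.length := by omega
  have hil : i + 1 < l.length := by omega
  rw [hf 0 hpos, hf _ hil] at h1
  rw [hf p hpl, hf i (by omega)] at h2
  have hsplit : l.take (i + 1) ++ l.drop (i + 1) = l := List.take_append_drop _ _
  have hperm : (l.take (i + 1) ++ (l.drop (i + 1)).reverse).Perm l := by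
    conv_rhs => rw [← hsplit]
    exact List.Perm.append_left _ (List.reverse_perm _)
  -- The cycle v₀ … v_i v_p … v_{i+1}, which uses the edge v_i v_p and closes through v_{i+1} v₀.
  refine ⟨l.take (i + 1) ++ (l.drop (i + 1)).reverse, ⟨?_, hperm.nodup_iff.2 hl.nodup, ?_⟩,
    hperm.length_eq, fun x => hperm.mem_iff, ?_⟩
  · refine (hl.chain.take _).append ?_ ?_
    · rw [List.isChain_reverse]; exact (hl.chain.drop _).imp fun _ _ h => h.symm
    · intro x hx y hy
      rw [List.getLast?_take] at hx
      rw [List.head?_reverse, List.getLast?_drop] at hy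
      simp [show i < l.length by omega, show ¬ l.length ≤ i + 1 by omega,
        List.getLast?_eq_getElem?, hpos] at hx hy
      subst hx; subst hy; exact h2.symm
  · intro x hx; exact hl.mem x (hperm.mem_iff.1 hx)
  · intro x hx y hy
    rw [List.getLast?_append, List.getLast?_reverse, List.head?_drop] at hx
    rw [List.head?_append, List.head?_take] at hy
    simp [hil, List.head?_eq_getElem?, hpos] at hx hy
    subst hx; subst hy; exact h1.symm

/-- A nonempty graph without a path on `2h+1` vertices has a vertex of degree less than `h`, or a
component with at most `2h` vertices each of which starts a Hamiltonian path of it. -/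
lemma exists_low_or_closed {X : Finset V} {h : ℕ} (hh : 1 ≤ h) (hX : X.Nonempty)
    (hno : ∀ l, IsPathIn G X l → l.length ≤ 2 * h) :
    (∃ v ∈ X, degIn G X v < h) ∨
    ∃ C ⊆ X, C.Nonempty ∧ C.card ≤ 2 * h ∧ (∀ x ∈ C, ∀ y ∈ X \ C, ¬ G.Adj x y) ∧
      ∀ x ∈ C, ∃ l, IsPathIn G C l ∧ l.length = C.card ∧ l.head? = some x := by
  by_cases hlow : ∃ v ∈ X, degIn G X v < h
  · exact Or.inl hlow
  push Not at hlow
  right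
  obtain ⟨l, hl, hne, hmax⟩ := exists_longest_path G hX
  obtain ⟨c, hc, hlen, hmem, hcyc⟩ := exists_cycle_of_longest hlow hl hne hmax hh (hno l hl)
  have hcard : c.toFinset.card = c.length := List.toFinset_card_of_nodup hc.nodup
  have hrot : ∀ x ∈ c, ∃ l', IsPathIn G c.toFinset l' ∧ l'.length = c.length ∧
      l'.head? = some x := by
    intro x hx
    obtain ⟨a, b, rfl⟩ := List.append_of_mem hx
    have hperm : ((x :: b) ++ a).Perm (a ++ x :: b) := List.perm_append_comm
    refine ⟨(x :: b) ++ a, ⟨?_, hperm.nodup_iff.2 hc.nodup, fun y hy =>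
      List.mem_toFinset.2 (hperm.mem_iff.1 hy)⟩, hperm.length_eq, by simp⟩
    have h0 := List.isChain_append.1 hc.chain
    refine h0.2.1.append h0.1 ?_
    intro u hu v hv
    refine hcyc u ?_ v ?_
    · rw [List.getLast?_append, hu]; rfl
    · rw [List.head?_append, hv]; rfl
  have hsub : c.toFinset ⊆ X := fun x hx => hc.mem x (List.mem_toFinset.1 hx)
  refine ⟨c.toFinset, hsub, ?_, ?_, ?_, ?_⟩
  · rw [← Finset.card_pos, hcard, hlen]; exact List.length_pos_iff.2 hne
  · rw [hcard]; exact hno c hc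
  -- An edge leaving the cycle would extend a Hamiltonian path of it beyond the maximal length.
  · intro x hx y hy hadj
    rw [Finset.mem_sdiff, List.mem_toFinset] at hy
    obtain ⟨l', hl', hlen', hhd⟩ := hrot x (List.mem_toFinset.1 hx)
    have := hmax _ ((hl'.mono hsub).cons hy.1 (fun h => hy.2 (List.mem_toFinset.1 (hl'.mem y h)))
      (by rw [hhd]; intro z hz; cases hz; exact hadj.symm))
    simp at this; omega
  · intro x hx
    rw [hcard]; exact hrot x (List.mem_toFinset.1 hx)

/-- The Erdős–Gallai bound for paths on `2h+1` vertices, improved by the number of vertices at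
which no path on `2h` vertices starts. -/
theorem cnt_add_card_le {h : ℕ} (hh : 1 ≤ h) (X S : Finset V)
    (hno : ∀ l, IsPathIn G X l → l.length ≤ 2 * h)
    (hS : ∀ l, IsPathIn G X l → l.length = 2 * h → ∀ x ∈ l.head?, x ∉ S) :
    cnt G X X + (X ∩ S).card ≤ (2 * h - 1) * X.card := by
  induction hn : X.card using Nat.strong_induction_on generalizing X with
  | _ n ih =>
  subst hn
  rcases X.eq_empty_or_nonempty with rfl | hX
  · simp [cnt]
  rcases exists_low_or_closed hh hX hno with ⟨v, hv, hd⟩ | ⟨C, hCX, hC, hCc, hcl, hpath⟩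
  -- Deleting v loses at most 2(h-1) ordered pairs and at most one element of S: 2h - 1 in all.
  · have hlt := Finset.card_erase_lt_of_mem hv
    have h1 := ih _ hlt (X.erase v)
      (fun l hl => hno l (hl.mono (Finset.erase_subset _ _)))
      (fun l hl => hS l (hl.mono (Finset.erase_subset _ _))) rfl
    have h2 : (X ∩ S).card ≤ (X.erase v ∩ S).card + 1 := by
      have := Finset.pred_card_le_card_erase (s := X ∩ S) (a := v)
      rw [Finset.erase_inter]
      omega
    have h3 := Finset.card_erase_add_one hv
    rw [cnt_erase hv, ← h3, mul_add]
    omega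
  · have hlt : (X \ C).card < X.card := Finset.card_lt_card (Finset.sdiff_ssubset hCX hC)
    have h1 := ih _ hlt (X \ C)
      (fun l hl => hno l (hl.mono Finset.sdiff_subset))
      (fun l hl => hS l (hl.mono Finset.sdiff_subset)) rfl
    have h2 : cnt G C (X \ C) = 0 := by
      refine Nat.le_zero.1 ((cnt_le_mul (c := 0) fun x hx => ?_).trans (by simp))
      exact (degIn_eq_zero.2 (hcl x hx)).le
    have h3 : (X ∩ S).card ≤ (C ∩ S).card + ((X \ C) ∩ S).card := by
      refine (Finset.card_le_card ?_).trans (Finset.card_union_le _ _)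
      intro x hx; simp only [Finset.mem_union, Finset.mem_inter, Finset.mem_sdiff] at hx ⊢; tauto
    have h4 : cnt G C C + (C ∩ S).card ≤ (2 * h - 1) * C.card := by
      have h5 := cnt_self_le (G := G) C
      have hpos : 0 < C.card := hC.card_pos
      -- For c = |C| < 2h, c(c-1) + c ≤ (2h-1)c even if C lies in S. For c = 2h the pairs may fill
      -- the whole bound, but each vertex of C starts a path on 2h vertices, so C misses S.
      rcases hCc.lt_or_eq with hlt | heq
      · have h6 : (C ∩ S).card ≤ C.card := Finset.card_le_card Finset.inter_subset_left
        have h7 : C.card * (C.card - 1) + C.card = C.card * C.card := by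
          obtain ⟨c, hc⟩ := Nat.exists_eq_add_of_lt hpos
          rw [hc]; simp; ring
        have h8 : C.card * C.card ≤ (2 * h - 1) * C.card := Nat.mul_le_mul_right _ (by omega)
        omega
      · have h6 : C ∩ S = ∅ := by
          rw [← Finset.disjoint_iff_inter_eq_empty, Finset.disjoint_left]
          intro x hx
          obtain ⟨l, hl, hlen, hhd⟩ := hpath x hx
          exact hS l (hl.mono hCX) (by omega) x (by simp [hhd])
        rw [h6]
        rw [heq] at h5 ⊢
        rw [mul_comm (2 * h - 1)]; simpa using h5
    have h5 : X.card = C.card + (X \ C).card := by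
      rw [Finset.card_sdiff_of_subset hCX]; have := Finset.card_le_card hCX; omega
    rw [cnt_split hCX, h2, h5, mul_add]
    omega

lemma cnt_le_of_no_path {h : ℕ} (hh : 1 ≤ h) (X : Finset V)
    (hno : ∀ l, IsPathIn G X l → l.length ≤ 2 * h) :
    cnt G X X ≤ (2 * h - 1) * X.card := by
  simpa using cnt_add_card_le hh X ∅ hno (by simp)

end Dirac

/-! ### Disjoint paths, and paths woven through a join -/

section HasPaths

variable {V : Type*} [DecidableEq V] {G : SimpleGraph V}

/-- `G` has `j` disjoint paths on `p` vertices each, all inside `X`. -/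
def HasPaths (G : SimpleGraph V) (p j : ℕ) (X : Finset V) : Prop :=
  ∃ L : List (List V), L.length = j ∧ (∀ l ∈ L, l.length = p ∧ l.IsChain G.Adj) ∧
    L.flatten.Nodup ∧ ∀ x ∈ L.flatten, x ∈ X

lemma HasPaths.mono {p j : ℕ} {X Y : Finset V} (h : HasPaths G p j X) (hXY : X ⊆ Y) :
    HasPaths G p j Y := by
  obtain ⟨L, h1, h2, h3, h4⟩ := h
  exact ⟨L, h1, h2, h3, fun x hx => hXY (h4 x hx)⟩

lemma hasPaths_zero (p : ℕ) (X : Finset V) : HasPaths G p 0 X := ⟨[], by simp⟩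

lemma HasPaths.add {p i j : ℕ} {X Y : Finset V} (hX : HasPaths G p i X) (hY : HasPaths G p j Y)
    (hXY : Disjoint X Y) : HasPaths G p (i + j) (X ∪ Y) := by
  obtain ⟨L, h1, h2, h3, h4⟩ := hX
  obtain ⟨M, k1, k2, k3, k4⟩ := hY
  refine ⟨L ++ M, by simp [h1, k1], ?_, ?_, ?_⟩
  · intro l hl
    rcases List.mem_append.1 hl with hl | hl
    · exact h2 l hl
    · exact k2 l hl
  · rw [List.flatten_append]
    exact h3.append k3 fun x hx hx' => Finset.disjoint_left.1 hXY (h4 x hx) (k4 x hx')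
  · intro x hx
    rw [List.flatten_append, List.mem_append] at hx
    exact Finset.mem_union.2 (hx.imp (h4 x) (k4 x))

lemma HasPaths.of_le {p i j : ℕ} {X : Finset V} (h : HasPaths G p j X) (hij : i ≤ j) :
    HasPaths G p i X := by
  obtain ⟨L, h1, h2, h3, h4⟩ := h
  have hs : (L.take i).flatten.Sublist L.flatten := (List.take_sublist i L).flatten
  exact ⟨L.take i, by simp [h1, hij], fun l hl => h2 l (List.mem_of_mem_take hl),
    h3.sublist hs, fun x hx => h4 x (hs.subset hx)⟩

lemma IsPathIn.hasPaths {p : ℕ} {X : Finset V} {l : List V} (h : IsPathIn G X l)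
    (hp : p ≤ l.length) : HasPaths G p 1 X := by
  have h' := h.take p
  refine ⟨[l.take p], rfl, ?_, by simpa using h'.nodup, by simpa using h'.mem⟩
  intro l' hl'
  rw [List.mem_singleton] at hl'; subst hl'
  exact ⟨by simp [hp], h'.chain⟩

lemma length_lt_of_not_hasPaths {p : ℕ} {X : Finset V} (h : ¬ HasPaths G p 1 X) {l : List V}
    (hl : IsPathIn G X l) : l.length < p := by
  by_contra hlt; exact h (hl.hasPaths (not_lt.1 hlt))

lemma HasPaths.shorten {p p' j : ℕ} {X : Finset V} (h : HasPaths G p j X) (hp : p' ≤ p) :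
    HasPaths G p' j X := by
  obtain ⟨L, h1, h2, h3, h4⟩ := h
  have key : ∀ L : List (List V), (L.map (List.take p')).flatten.Sublist L.flatten := by
    intro L
    induction L with
    | nil => simp
    | cons l L ih => simpa using (List.take_sublist p' l).append ih
  refine ⟨L.map (List.take p'), by simp [h1], ?_, h3.sublist (key L),
    fun x hx => h4 x ((key L).subset hx)⟩
  intro l hl
  obtain ⟨l', hl', rfl⟩ := List.mem_map.1 hl
  exact ⟨by simp [(h2 l' hl').1, hp], (h2 l' hl').2.take _⟩

/-- The paths only meet `j * p` vertices. -/
lemma HasPaths.exists_small {p j : ℕ} {X : Finset V} (h : HasPaths G p j X) :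
    ∃ Y ⊆ X, Y.card = j * p ∧ HasPaths G p j Y := by
  obtain ⟨L, h1, h2, h3, h4⟩ := h
  refine ⟨L.flatten.toFinset, fun x hx => h4 x (List.mem_toFinset.1 hx), ?_, L, h1, h2, h3,
    fun x hx => List.mem_toFinset.2 hx⟩
  rw [List.toFinset_card_of_nodup h3, List.length_flatten]
  have : L.map List.length = List.replicate j p := by
    rw [List.eq_replicate_iff]
    refine ⟨by simp [h1], ?_⟩
    intro b hb
    obtain ⟨l, hl, rfl⟩ := List.mem_map.1 hb
    exact (h2 l hl).1
  rw [this]; simp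

/-- The sequence `s, w₁, S₁, w₂, S₂, …` -/
def weave : List V → List V → List (List V) → List V
  | s, w :: ws, t :: S => weave (s ++ w :: t) ws S
  | s, _, _ => s

lemma weave_perm : ∀ (s ws : List V) (S : List (List V)), ws.length = S.length →
    (weave s ws S).Perm (s ++ ws ++ S.flatten)
  | s, [], [], _ => by simp [weave]
  | s, w :: ws, t :: S, h => by
      have := weave_perm (s ++ w :: t) ws S (by simpa using h)
      rw [weave]
      refine this.trans ?_
      simp only [List.flatten_cons, List.append_assoc, List.cons_append]
      refine List.Perm.append_left s (List.Perm.cons w ?_)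
      rw [← List.append_assoc, ← List.append_assoc]
      exact List.Perm.append_right _ List.perm_append_comm
  | _, [], _ :: _, h => by simp at h
  | _, _ :: _, [], h => by simp at h

lemma weave_chain {J : Finset V} : ∀ (s ws : List V) (S : List (List V)),
    s.IsChain G.Adj → (∀ x ∈ s.getLast?, ∀ y ∈ ws.head?, G.Adj x y) →
    (∀ w ∈ ws, ∀ x ∈ J, G.Adj w x) →
    (∀ t ∈ S, t.IsChain G.Adj ∧ t ≠ [] ∧ (∀ x ∈ t.head?, x ∈ J) ∧ ∀ x ∈ t.getLast?, x ∈ J) →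
    (weave s ws S).IsChain G.Adj
  | s, w :: ws, t :: S, hs, hsw, hw, hS => by
      rw [weave]
      obtain ⟨h1, h2, h3, h4⟩ := hS t List.mem_cons_self
      refine weave_chain (s ++ w :: t) ws S ?_ ?_
        (fun w hw' => hw w (List.mem_cons_of_mem _ hw')) (fun t ht => hS t (List.mem_cons_of_mem _ ht))
      · refine hs.append (List.isChain_cons.2 ⟨fun y hy => hw w List.mem_cons_self y (h3 y hy), h1⟩) ?_
        simpa using hsw
      · intro x hx y hy
        have hx' : x ∈ t.getLast? := by
          rw [List.getLast?_append, List.getLast?_cons] at hx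
          rw [List.getLast?_eq_some_getLast h2] at hx ⊢
          simpa using hx
        exact (hw y (List.mem_cons_of_mem _ (List.mem_of_mem_head? hy)) x (h4 x hx')).symm
  | s, [], _, hs, _, _, _ => by simpa [weave] using hs
  | s, _ :: _, [], hs, _, _, _ => by simpa [weave] using hs

/-- Segments with ends in `J`, joined through vertices adjacent to all of `J`, form a path. -/
lemma isPathIn_weave {X J : Finset V} {s ws : List V} {S : List (List V)}
    (hlen : ws.length = S.length)
    (hs : s.IsChain G.Adj) (hsw : ∀ x ∈ s.getLast?, ∀ y ∈ ws.head?, G.Adj x y)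
    (hw : ∀ w ∈ ws, ∀ x ∈ J, G.Adj w x)
    (hS : ∀ t ∈ S, t.IsChain G.Adj ∧ t ≠ [] ∧ (∀ x ∈ t.head?, x ∈ J) ∧ ∀ x ∈ t.getLast?, x ∈ J)
    (hnd : (s ++ ws ++ S.flatten).Nodup) (hX : ∀ x ∈ s ++ ws ++ S.flatten, x ∈ X) :
    IsPathIn G X (weave s ws S) ∧
      (weave s ws S).length = s.length + ws.length + S.flatten.length := by
  have hp := weave_perm s ws S hlen
  refine ⟨⟨weave_chain s ws S hs hsw hw hS, hp.nodup_iff.2 hnd, fun x hx => hX x (hp.mem_iff.1 hx)⟩,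
    ?_⟩
  rw [hp.length_eq]; simp [add_assoc]

lemma exists_list_of_le_card {X : Finset V} {t : ℕ} (h : t ≤ X.card) :
    ∃ l : List V, l.length = t ∧ l.Nodup ∧ ∀ x ∈ l, x ∈ X := by
  obtain ⟨Y, hY, hc⟩ := Finset.exists_subset_card_eq h
  exact ⟨Y.toList, by simp [hc], Y.nodup_toList, fun x hx => hY (by simpa using hx)⟩

lemma flatten_map_singleton (l : List V) : (l.map fun x => [x]).flatten = l := by
  induction l <;> simp_all

lemma disjoint_of_join {A J : Finset V} (h : ∀ a ∈ A, ∀ x ∈ J, G.Adj a x) : Disjoint A J :=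
  Finset.disjoint_left.2 fun a ha ha' => (h a ha a ha').ne rfl

/-- A segment whose last vertex is adjacent to `a ∈ A` extends by a path alternating between `A`
and `J`. -/
lemma exists_path_extending {A J : Finset V} (hAJ : ∀ a ∈ A, ∀ x ∈ J, G.Adj a x)
    (hcard : A.card ≤ J.card) {s : List V} (hs : s.IsChain G.Adj) (hnd : s.Nodup)
    (hsA : ∀ x ∈ s, x ∉ A) (hsJ : ∀ x ∈ s, x ∉ J) {a : V} (ha : a ∈ A)
    (hsa : ∀ x ∈ s.getLast?, G.Adj x a) :
    ∃ l, IsPathIn G (s.toFinset ∪ (A ∪ J)) l ∧ l.length = s.length + 2 * A.card := by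
  obtain ⟨js, h1, h2, h3⟩ := exists_list_of_le_card hcard
  have hdisj := Finset.disjoint_left.1 (disjoint_of_join hAJ)
  have hws : ∀ x ∈ a :: (A.erase a).toList, x ∈ A := by
    intro x hx; simp at hx; rcases hx with rfl | hx
    · exact ha
    · exact hx.2
  have hwl : (a :: (A.erase a).toList).length = A.card := by
    simp [Finset.card_erase_of_mem ha]; have := Finset.card_pos.2 ⟨a, ha⟩; omega
  obtain ⟨h4, h5⟩ := isPathIn_weave (G := G) (X := s.toFinset ∪ (A ∪ J)) (J := J) (s := s)
    (ws := a :: (A.erase a).toList) (S := js.map fun x => [x])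
    (by rw [hwl]; simp [h1]) hs (by simpa using hsa)
    (fun w hw x hx => hAJ w (hws w hw) x hx)
    (by
      intro t ht; obtain ⟨x, hx, rfl⟩ := List.mem_map.1 ht
      simpa using h3 x hx)
    (by
      rw [flatten_map_singleton]
      refine List.Nodup.append (List.Nodup.append hnd ?_ ?_) h2 ?_
      · exact List.nodup_cons.2 ⟨by simp, Finset.nodup_toList _⟩
      · exact fun x hx hx' => hsA x hx (hws x hx')
      · intro x hx hx'
        rcases List.mem_append.1 hx with hx | hx
        · exact hsJ x hx (h3 x hx')
        · exact hdisj (hws x hx) (h3 x hx'))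
    (by
      rw [flatten_map_singleton]
      intro x hx
      simp only [List.append_assoc, List.mem_append] at hx
      simp only [Finset.mem_union, List.mem_toFinset]
      exact hx.imp id (Or.imp (hws x) (h3 x)))
  refine ⟨_, h4, ?_⟩
  rw [h5, flatten_map_singleton, hwl, h1]; ring

/-- A complete bipartite graph contains the paths that its part sizes allow. -/
lemma hasPaths_of_join {h : ℕ} (hh : 1 ≤ h) (t : ℕ) : ∀ (A J : Finset V),
    (∀ a ∈ A, ∀ x ∈ J, G.Adj a x) → t * h ≤ A.card → t * (h + 1) ≤ J.card →
    HasPaths G (2 * h + 1) t (A ∪ J) := by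
  induction t with
  | zero => intros; exact hasPaths_zero _ _
  | succ t ih =>
    intro A J hAJ hA hJ
    rw [add_mul, one_mul] at hA hJ
    obtain ⟨A', hA', hAc⟩ := Finset.exists_subset_card_eq (show h ≤ A.card by omega)
    obtain ⟨J', hJ', hJc⟩ := Finset.exists_subset_card_eq (show h + 1 ≤ J.card by omega)
    have hdisj := disjoint_of_join hAJ
    obtain ⟨x, hx⟩ : J'.Nonempty := by rw [← Finset.card_pos]; omega
    obtain ⟨a, ha⟩ : A'.Nonempty := by rw [← Finset.card_pos]; omega
    have hAJ' : ∀ a ∈ A', ∀ y ∈ J'.erase x, G.Adj a y := fun a ha y hy =>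
      hAJ a (hA' ha) y (hJ' (Finset.mem_of_mem_erase hy))
    -- The path starts and ends in J, so it takes h vertices of A and h + 1 of J.
    obtain ⟨l, h1, h2⟩ := exists_path_extending (s := [x]) hAJ'
      (by rw [Finset.card_erase_of_mem hx]; omega) (by simp) (by simp)
      (by
        intro y hy; rw [List.mem_singleton] at hy; subst hy
        exact fun h => Finset.disjoint_left.1 hdisj (hA' h) (hJ' hx)) (by simp) ha
      (by
        intro y hy; simp at hy; subst hy
        exact (hAJ a (hA' ha) _ (hJ' hx)).symm)
    have h3 : HasPaths G (2 * h + 1) 1 (A' ∪ J') := by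
      refine (h1.hasPaths (by simp [h2]; omega)).mono ?_
      intro y hy
      simp only [List.toFinset_cons, List.toFinset_nil, Finset.mem_union, Finset.mem_erase,
        Finset.mem_insert] at hy ⊢
      rcases hy with (rfl | h) | h | h
      · exact Or.inr hx
      · simp at h
      · exact Or.inl h
      · exact Or.inr h.2
    have h4 := ih (A \ A') (J \ J')
      (fun a ha x hx => hAJ a (Finset.sdiff_subset ha) x (Finset.sdiff_subset hx))
      (by rw [Finset.card_sdiff_of_subset hA']; omega)
      (by rw [Finset.card_sdiff_of_subset hJ']; omega)
    refine (h4.add h3 ?_).mono ?_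
    · rw [Finset.disjoint_left]
      rw [Finset.disjoint_left] at hdisj
      intro y hy hy'
      simp only [Finset.mem_union, Finset.mem_sdiff] at hy hy'
      rcases hy with h | h <;> rcases hy' with h' | h'
      · exact h.2 h'
      · exact hdisj h.1 (hJ' h')
      · exact hdisj (hA' h') h.1
      · exact h.2 h'
    · refine Finset.union_subset (Finset.union_subset_union Finset.sdiff_subset
        Finset.sdiff_subset) (Finset.union_subset_union hA' hJ')

end HasPaths

/-! ### Splitting off h vertices at the cost of one path -/

section Turan

variable {V : Type*} [DecidableEq V] {G : SimpleGraph V} [DecidableRel G.Adj]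

/-- If there are many edges between `Y` and `P`, then some `h` vertices of `P` have many common
neighbours in `Y`. -/
lemma exists_common_of_cnt {h M : ℕ} (hh : 1 ≤ h) {P Y : Finset V} (hP : P.card = 2 * h + 1)
    (hcnt : (h - 1) * Y.card + (h + 2) * (M * (2 * h + 1).choose h) ≤ cnt G Y P) :
    ∃ U ⊆ P, U.card = h ∧ M ≤ (Y.filter fun y => ∀ u ∈ U, G.Adj u y).card := by
  let N := Y.filter fun y => h ≤ degIn G P y
  have hN : M * (2 * h + 1).choose h ≤ N.card := by
    -- The constant h + 2 comes from |P| = 2h + 1 = (h - 1) + (h + 2).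
    have h1 : cnt G Y P ≤ ∑ y ∈ Y, ((h - 1) + if h ≤ degIn G P y then (h + 2) else 0) := by
      refine Finset.sum_le_sum fun y _ => ?_
      have := degIn_le_card (G := G) P y
      split_ifs <;> omega
    rw [Finset.sum_add_distrib, ← Finset.sum_filter] at h1
    simp only [Finset.sum_const, smul_eq_mul] at h1
    have h2 : (h + 2) * (M * (2 * h + 1).choose h) ≤ (h + 2) * N.card := by
      rw [mul_comm (h + 2) N.card]
      rw [mul_comm Y.card] at h1
      exact Nat.le_of_add_le_add_left (hcnt.trans h1)
    exact Nat.le_of_mul_le_mul_left h2 (by omega)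
  have hex : ∀ y : V, ∃ U : Finset V, h ≤ degIn G P y →
      U ⊆ P.filter (G.Adj y) ∧ U.card = h := by
    intro y
    by_cases hy : h ≤ degIn G P y
    · obtain ⟨U, h1, h2⟩ := Finset.exists_subset_card_eq hy
      exact ⟨U, fun _ => ⟨h1, h2⟩⟩
    · exact ⟨∅, fun h => absurd h hy⟩
  choose f hf using hex
  -- Pigeonhole: each vertex of N picks h of its neighbours in P, and some h-subset is picked at
  -- least M times.
  obtain ⟨U, hU, hUM⟩ := Finset.exists_le_card_fiber_of_mul_le_card_of_maps_to
    (s := N) (t := P.powersetCard h) (f := f) (n := M)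
    (by
      intro y hy
      obtain ⟨h1, h2⟩ := hf y (Finset.mem_filter.1 hy).2
      exact Finset.mem_powersetCard.2 ⟨h1.trans (Finset.filter_subset _ _), h2⟩)
    (Finset.powersetCard_nonempty.2 (by omega))
    (by rw [Finset.card_powersetCard, hP, mul_comm]; exact hN)
  rw [Finset.mem_powersetCard] at hU
  refine ⟨U, hU.1, hU.2, hUM.trans (Finset.card_le_card ?_)⟩
  intro y hy
  rw [Finset.mem_filter] at hy
  obtain ⟨hyN, rfl⟩ := hy
  rw [Finset.mem_filter] at hyN
  refine Finset.mem_filter.2 ⟨hyN.1, fun u hu => ?_⟩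
  exact ((Finset.mem_filter.1 ((hf y hyN.2).1 hu)).2).symm

/-- `h` vertices with many common neighbours can be split off at the cost of one path. -/
lemma not_hasPaths_sdiff {h j k : ℕ} (hh : 1 ≤ h) (hjk : j + 1 ≤ k) {X U N : Finset V}
    (hno : ¬ HasPaths G (2 * h + 1) (j + 1) X) (hUX : U ⊆ X) (hU : U.card = h)
    (hNX : N ⊆ X) (hN : ∀ u ∈ U, ∀ y ∈ N, G.Adj u y) (hNc : k * (2 * h + 1) ≤ N.card) :
    ¬ HasPaths G (2 * h + 1) j (X \ U) := by
  intro hp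
  obtain ⟨Y, hYX, hYc, hY⟩ := hp.exists_small
  -- The j paths avoid U and meet only j(2h+1) vertices, so enough of N remains to form one more
  -- path through U.
  have h1 : HasPaths G (2 * h + 1) 1 (U ∪ (N \ Y)) := by
    refine hasPaths_of_join hh 1 U (N \ Y)
      (fun u hu y hy => hN u hu y (Finset.sdiff_subset hy)) (by omega) ?_
    have h2 := Finset.le_card_sdiff Y N
    have h3 : (j + 1) * (2 * h + 1) ≤ k * (2 * h + 1) := Nat.mul_le_mul_right _ hjk
    rw [add_mul] at h3
    omega
  refine hno ((hY.add h1 ?_).mono ?_)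
  · rw [Finset.disjoint_union_right]
    exact ⟨Finset.disjoint_of_subset_left hYX Finset.sdiff_disjoint, Finset.disjoint_sdiff⟩
  · exact Finset.union_subset (hYX.trans Finset.sdiff_subset)
      (Finset.union_subset hUX (Finset.sdiff_subset.trans hNX))

lemma exists_split_of_path {h j k : ℕ} (hh : 1 ≤ h) (hjk : j + 1 ≤ k) {X P : Finset V}
    (hno : ¬ HasPaths G (2 * h + 1) (j + 1) X) (hPX : P ⊆ X) (hP : P.card = 2 * h + 1)
    (hcnt : (h - 1) * (X \ P).card + (h + 2) * (k * (2 * h + 1) * (2 * h + 1).choose h) ≤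
      cnt G (X \ P) P) :
    ∃ U ⊆ X, U.card = h ∧ ¬ HasPaths G (2 * h + 1) j (X \ U) := by
  obtain ⟨U, hUP, hU, hUc⟩ := exists_common_of_cnt hh hP hcnt
  refine ⟨U, hUP.trans hPX, hU, not_hasPaths_sdiff hh hjk hno (hUP.trans hPX) hU
    ((Finset.filter_subset _ _).trans Finset.sdiff_subset) ?_ hUc⟩
  intro u hu y hy
  exact (Finset.mem_filter.1 hy).2 u hu

/-- Error term in the bound for graphs without `j` disjoint paths. -/
def errTerm (h k : ℕ) : ℕ :=
  (2 * h + 1) ^ 2 + 2 * ((h + 2) * (k * (2 * h + 1) * (2 * h + 1).choose h))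

lemma exists_path_removal {h j : ℕ} {X : Finset V}
    (hno : ¬ HasPaths G (2 * h + 1) (j + 1) X) (hX : HasPaths G (2 * h + 1) 1 X) :
    ∃ P ⊆ X, P.card = 2 * h + 1 ∧ ¬ HasPaths G (2 * h + 1) j (X \ P) := by
  obtain ⟨P, hPX, hPc, hP⟩ := hX.exists_small
  refine ⟨P, hPX, by simpa using hPc, fun h => hno ?_⟩
  rw [← Finset.sdiff_union_of_subset hPX]
  exact h.add hP Finset.sdiff_disjoint

/-- Induction by two deletions. Deleting a path P leaves a graph covered by the induction
hypothesis, so if the bound failed, P would send more than about h|X| edges outside. Some h vertices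
U of P could then be split off. Deleting U costs at most 2h|X| ordered pairs, which is exactly the
growth of the leading coefficient, and the induction hypothesis applies again. -/
lemma cnt_le_of_not_hasPaths {h k : ℕ} (hh : 1 ≤ h) (j : ℕ) : ∀ (X : Finset V), j + 1 ≤ k →
    ¬ HasPaths G (2 * h + 1) (j + 1) X →
    cnt G X X ≤ (2 * (j + 1) * h - 1) * X.card + j * errTerm h k := by
  induction j with
  | zero =>
    intro X _ hno
    have := cnt_le_of_no_path hh X fun l hl =>
      Nat.le_of_lt_succ (length_lt_of_not_hasPaths hno hl)
    simpa using this
  | succ j ih =>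
    intro X hjk hno
    by_cases hX : HasPaths G (2 * h + 1) 1 X
    swap
    · have := cnt_le_of_no_path hh X fun l hl =>
        Nat.le_of_lt_succ (length_lt_of_not_hasPaths hX hl)
      refine this.trans (le_add_right (Nat.mul_le_mul_right _ ?_))
      have : h ≤ (j + 1 + 1) * h := Nat.le_mul_of_pos_left _ (by omega)
      rw [mul_assoc]; omega
    obtain ⟨P, hPX, hP, hnoP⟩ := exists_path_removal hno hX
    have hY := ih (X \ P) (by omega) hnoP
    by_contra hcon
    push Not at hcon
    have hYX : (X \ P).card ≤ X.card := Finset.card_le_card Finset.sdiff_subset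
    have hPP := cnt_self_le (G := G) P
    rw [hP] at hPP
    have hsp := cnt_split (G := G) hPX
    have hA : (2 * (j + 1 + 1) * h - 1) = (2 * (j + 1) * h - 1) + 2 * h := by
      have : 1 ≤ (j + 1) * h := Nat.mul_pos (by omega) hh
      have e1 : 2 * (j + 1 + 1) * h = 2 * ((j + 1) * h) + 2 * h := by ring
      have e2 : 2 * (j + 1) * h = 2 * ((j + 1) * h) := by ring
      omega
    obtain ⟨U, hUX, hU, hnoU⟩ := exists_split_of_path hh hjk hno hPX hP (by
      rw [cnt_comm (X \ P) P]
      have h1 : (2 * (j + 1) * h - 1) * (X \ P).card ≤ (2 * (j + 1) * h - 1) * X.card :=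
        Nat.mul_le_mul_left _ hYX
      have h2 : (h - 1) * (X \ P).card ≤ h * X.card := Nat.mul_le_mul (by omega) hYX
      have h3 : (2 * h + 1) * (2 * h + 1 - 1) ≤ (2 * h + 1) ^ 2 := by
        rw [sq]; exact Nat.mul_le_mul_left _ (by omega)
      rw [hA, add_mul, add_mul, one_mul] at hcon
      have h4 : errTerm h k = (2 * h + 1) ^ 2 +
        2 * ((h + 2) * (k * (2 * h + 1) * (2 * h + 1).choose h)) := rfl
      have h5 : 2 * h * X.card = 2 * (h * X.card) := by ring
      omega)
    have h1 := ih (X \ U) (by omega) hnoU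
    have h2 := cnt_split (G := G) hUX
    have h3 : cnt G U U + cnt G U (X \ U) ≤ h * X.card := by
      rw [← cnt_union_right Finset.disjoint_sdiff, Finset.union_sdiff_of_subset hUX, ← hU]
      exact cnt_le_card_mul U X
    have h4 : (2 * (j + 1) * h - 1) * (X \ U).card ≤ (2 * (j + 1) * h - 1) * X.card :=
      Nat.mul_le_mul_left _ (Finset.card_le_card Finset.sdiff_subset)
    rw [hA, add_mul, add_mul, one_mul] at hcon
    have h5 : 2 * h * X.card = 2 * (h * X.card) := by ring
    omega

/-- A dense graph without `k` disjoint paths becomes path-free after the removal of `(k-1)h`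
vertices. -/
lemma exists_path_free_sdiff {h k : ℕ} (hh : 1 ≤ h) (hk : 1 ≤ k) {X : Finset V}
    (hno : ¬ HasPaths G (2 * h + 1) k X)
    (hcnt : 2 * (k * h - 1) * (X.card - (k * h - 1)) ≤ cnt G X X)
    (hbig : 2 * (k * h) ^ 2 + k * errTerm h k ≤ X.card) (i : ℕ) : i + 1 ≤ k →
    ∃ W ⊆ X, W.card = i * h ∧ ¬ HasPaths G (2 * h + 1) (k - i) (X \ W) := by
  induction i with
  | zero => intro _; exact ⟨∅, by simp, by simp, by simpa using hno⟩
  | succ i ih =>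
    intro hik
    obtain ⟨W, hWX, hW, hnoW⟩ := ih (by omega)
    obtain ⟨j, rfl⟩ : ∃ j, k = i + (j + 1) + 1 := ⟨k - i - 2, by omega⟩
    set k := i + (j + 1) + 1 with hkdef
    have hki : k - i = (j + 1) + 1 := by omega
    have hki' : k - (i + 1) = j + 1 := by omega
    rw [hki] at hnoW
    rw [hki']
    set Y := X \ W with hYdef
    have hYX : Y.card ≤ X.card := Finset.card_le_card Finset.sdiff_subset
    have hkh : k * h = i * h + (j + 1) * h + h := by rw [hkdef]; ring
    have hjh : 1 ≤ (j + 1) * h := Nat.mul_pos (by omega) hh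
    -- Deleting W costs at most 2ih|X| ordered pairs. What is left is about 2(kh - ih - 1)|X|, where
    -- kh - ih = (j + 2)h.
    have hcY : (2 * ((j + 1) * h) + 2 * h - 2) * X.card ≤ cnt G Y Y + 2 * (k * h) ^ 2 := by
      have h2 := cnt_split (G := G) hWX
      have h3 : cnt G W W + cnt G W Y ≤ (i * h) * X.card := by
        rw [← cnt_union_right Finset.disjoint_sdiff, Finset.union_sdiff_of_subset hWX, ← hW]
        exact cnt_le_card_mul W X
      have h4 : k * h - 1 ≤ X.card := by
        have : k * h ≤ (k * h) ^ 2 := Nat.le_self_pow (by norm_num) _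
        omega
      zify [show 1 ≤ k * h by omega, h4, show 2 ≤ 2 * ((j + 1) * h) + 2 * h by omega] at *
      nlinarith
    by_cases hP : HasPaths G (2 * h + 1) 1 Y
    swap
    · exfalso
      have h1 := cnt_le_of_no_path hh Y fun l hl =>
        Nat.le_of_lt_succ (length_lt_of_not_hasPaths hP hl)
      have h2 : (2 * h - 1) * Y.card ≤ (2 * h - 1) * X.card := Nat.mul_le_mul_left _ hYX
      have h3 : (2 * ((j + 1) * h) + 2 * h - 2) * X.card
          = (2 * ((j + 1) * h) - 1) * X.card + (2 * h - 1) * X.card := by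
        rw [← add_mul]; congr 1; omega
      have h4 : 1 * X.card ≤ (2 * ((j + 1) * h) - 1) * X.card :=
        Nat.mul_le_mul_right _ (by omega)
      have h5 : 0 < k * errTerm h k := Nat.mul_pos hk (by unfold errTerm; positivity)
      omega
    obtain ⟨P, hPY, hPc, hnoP⟩ := exists_path_removal hnoW hP
    -- Inside Y \ P there are at most about (2(j+1)h - 1)|X| pairs. Twice the number of edges
    -- between P and Y \ P is thus about 2(h-1)|X| + |X| or more, and the spare |X| absorbs all
    -- error terms.
    obtain ⟨U, hUY, hU, hnoU⟩ := exists_split_of_path (k := k) hh (by omega) hnoW hPY hPc (by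
      rw [cnt_comm (Y \ P) P]
      have h1 := cnt_le_of_not_hasPaths (k := k) hh j (Y \ P) (by omega) hnoP
      have hPP := cnt_self_le (G := G) P
      rw [hPc] at hPP
      have hsp := cnt_split (G := G) hPY
      have hYP : (Y \ P).card ≤ X.card := (Finset.card_le_card Finset.sdiff_subset).trans hYX
      have h2 : (h - 1) * (Y \ P).card ≤ (h - 1) * X.card := Nat.mul_le_mul_left _ hYP
      have h3 : (2 * (j + 1) * h - 1) * (Y \ P).card ≤ (2 * ((j + 1) * h) - 1) * X.card := by
        rw [mul_assoc]; exact Nat.mul_le_mul_left _ hYP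
      have h4 : (2 * h + 1) * (2 * h + 1 - 1) ≤ (2 * h + 1) ^ 2 := by
        rw [sq]; exact Nat.mul_le_mul_left _ (by omega)
      have h5 : (2 * ((j + 1) * h) + 2 * h - 2) * X.card
          = (2 * ((j + 1) * h) - 1) * X.card + 2 * ((h - 1) * X.card) + X.card := by
        have : 2 * ((j + 1) * h) + 2 * h - 2 = (2 * ((j + 1) * h) - 1) + 2 * (h - 1) + 1 := by
          omega
        rw [this]; ring
      have h6 : errTerm h k = (2 * h + 1) ^ 2 +
        2 * ((h + 2) * (k * (2 * h + 1) * (2 * h + 1).choose h)) := rfl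
      have h7 : j * errTerm h k + errTerm h k ≤ k * errTerm h k := by
        rw [← Nat.succ_mul]; exact Nat.mul_le_mul_right _ (by omega)
      omega)
    refine ⟨W ∪ U, Finset.union_subset hWX (hUY.trans Finset.sdiff_subset), ?_, ?_⟩
    · rw [Finset.card_union_of_disjoint, hW, hU]; · ring
      exact Finset.disjoint_of_subset_right hUY Finset.disjoint_sdiff
    · rw [Finset.sdiff_union_distrib]
      have : Y \ U = X \ W ∩ (X \ U) := by
        ext x; simp [hYdef]; tauto
      rwa [← this]

end Turan

/-! ### Three-vertex segments that save connecting vertices -/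

section Segments

variable {V : Type*} [DecidableEq V] {G : SimpleGraph V}

/-- A path on three vertices with both ends in `J`. -/
def IsSeg (G : SimpleGraph V) (J : Finset V) (l : List V) : Prop :=
  l.length = 3 ∧ l.IsChain G.Adj ∧ (∀ x ∈ l.head?, x ∈ J) ∧ ∀ x ∈ l.getLast?, x ∈ J

/-- Greedy choice: when a disjoint family cannot be enlarged, its own vertices meet every list
satisfying `Pr`. -/
lemma exists_family_or_hitting (Pr : List V → Prop) {c : ℕ}
    (hPr : ∀ l, Pr l → l.length = c ∧ l.Nodup) (t : ℕ) :
    (∃ L : List (List V), L.length = t ∧ (∀ l ∈ L, Pr l) ∧ L.flatten.Nodup) ∨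
    ∃ R : Finset V, R.card ≤ c * t ∧ (∀ x ∈ R, ∃ l, Pr l ∧ x ∈ l) ∧
      ∀ l, Pr l → ∃ x ∈ l, x ∈ R := by
  induction t with
  | zero => exact Or.inl ⟨[], by simp⟩
  | succ t ih =>
    rcases ih with ⟨L, h1, h2, h3⟩ | ⟨R, h1, h2, h3⟩
    · by_cases hex : ∃ l, Pr l ∧ ∀ x ∈ l, x ∉ L.flatten
      · obtain ⟨l, hl, hd⟩ := hex
        refine Or.inl ⟨l :: L, by simp [h1], ?_, ?_⟩
        · intro l' hl'
          rcases List.mem_cons.1 hl' with rfl | h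
          · exact hl
          · exact h2 _ h
        · rw [List.flatten_cons]
          exact (hPr l hl).2.append h3 fun x hx hx' => hd x hx hx'
      · push Not at hex
        refine Or.inr ⟨L.flatten.toFinset, ?_, ?_, ?_⟩
        · rw [List.toFinset_card_of_nodup h3, List.length_flatten]
          have : L.map List.length = List.replicate t c := by
            rw [List.eq_replicate_iff]
            refine ⟨by simp [h1], fun b hb => ?_⟩
            obtain ⟨l, hl, rfl⟩ := List.mem_map.1 hb
            exact (hPr l (h2 l hl)).1
          rw [this, List.sum_replicate, smul_eq_mul, mul_comm]
          exact Nat.mul_le_mul_left _ (by omega)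
        · intro x hx
          obtain ⟨l, hl, hxl⟩ := List.mem_flatten.1 (List.mem_toFinset.1 hx)
          exact ⟨l, h2 l hl, hxl⟩
        · intro l hl
          obtain ⟨x, hx, hx'⟩ := hex l hl
          exact ⟨x, hx, List.mem_toFinset.2 hx'⟩
    · exact Or.inr ⟨R, h1.trans (Nat.mul_le_mul_left _ (by omega)), h2, h3⟩

/-- Centres are treated greedily, with U collecting the forbidden vertices. Each step adds two
vertices to U and drops one from B, so |U| + 2|B| does not grow. -/
lemma exists_stars [DecidableRel G.Adj] {J : Finset V} (B : Finset V) : ∀ (U : Finset V), B ⊆ U →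
    (∀ x ∈ B, U.card + 2 * B.card ≤ degIn G J x) →
    ∃ L : List (List V), L.length = B.card ∧ (∀ l ∈ L, IsSeg G J l) ∧ L.flatten.Nodup ∧
      ∀ y ∈ L.flatten, y ∈ B ∨ (y ∈ J ∧ y ∉ U) := by
  induction B using Finset.induction_on with
  | empty => intro U _ _; exact ⟨[], by simp⟩
  | insert x B hxB ih =>
    intro U hBU hdeg
    rw [Finset.card_insert_of_notMem hxB] at hdeg
    have hx := hdeg x (Finset.mem_insert_self _ _)
    have h1 : 2 ≤ (J.filter (G.Adj x) \ U).card := by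
      have := Finset.le_card_sdiff U (J.filter (G.Adj x))
      unfold degIn at hx; omega
    obtain ⟨p, hp, q, hq, hpq⟩ := Finset.one_lt_card.1 h1
    simp only [Finset.mem_sdiff, Finset.mem_filter] at hp hq
    obtain ⟨L, h2, h3, h4, h5⟩ := ih (insert p (insert q U))
      (fun y hy => by simp [hBU (Finset.mem_insert_of_mem hy)])
      (fun y hy => by
        have h6 := hdeg y (Finset.mem_insert_of_mem hy)
        have h7 := Finset.card_insert_le p (insert q U)
        have h8 := Finset.card_insert_le q U
        omega)
    have hxU : x ∈ U := hBU (Finset.mem_insert_self _ _)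
    refine ⟨[p, x, q] :: L, by simp [h2, hxB], ?_, ?_, ?_⟩
    · intro l hl
      rcases List.mem_cons.1 hl with rfl | hl
      · exact ⟨rfl, by simp [hp.1.2.symm, hq.1.2], by simp [hp.1.1], by simp [hq.1.1]⟩
      · exact h3 l hl
    · rw [List.flatten_cons]
      refine List.Nodup.append ?_ h4 ?_
      · have := hp.1.2.ne; have := hq.1.2.ne
        simp; grind
      · intro y hy hy'
        have h6 := h5 y hy'
        have hpB : p ∉ B := fun h => hp.2 (hBU (Finset.mem_insert_of_mem h))
        have hqB : q ∉ B := fun h => hq.2 (hBU (Finset.mem_insert_of_mem h))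
        simp at hy h6
        rcases hy with rfl | rfl | rfl <;> tauto
    · intro y hy
      rw [List.flatten_cons, List.mem_append] at hy
      rcases hy with hy | hy
      · simp at hy
        rcases hy with rfl | rfl | rfl
        · exact Or.inr ⟨hp.1.1, hp.2⟩
        · exact Or.inl (Finset.mem_insert_self _ _)
        · exact Or.inr ⟨hq.1.1, hq.2⟩
      · have h6 := h5 y hy
        simp at h6 ⊢; tauto

/-- `s` segments replace `s` of the `h` connecting vertices of a path on `2h+1` vertices. -/
lemma hasPaths_of_segs {h s : ℕ} (hs : 1 ≤ s) (hsh : 2 * s ≤ h + 1) {W J J' : Finset V}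
    {L : List (List V)} (hL : L.length = s) (hseg : ∀ l ∈ L, IsSeg G J l) (hnd : L.flatten.Nodup)
    (hW : W.card = h - s) (hJ'J : J' ⊆ J) (hJ' : J'.card = h + 1 - 2 * s)
    (hWJ : ∀ w ∈ W, ∀ x ∈ J, G.Adj w x) (hLW : ∀ x ∈ L.flatten, x ∉ W)
    (hLJ : ∀ x ∈ L.flatten, x ∉ J') :
    HasPaths G (2 * h + 1) 1 (W ∪ J' ∪ L.flatten.toFinset) := by
  have hdisj := Finset.disjoint_left.1 (disjoint_of_join hWJ)
  have hfl : ∀ L : List (List V), (∀ l ∈ L, IsSeg G J l) → L.flatten.length = 3 * L.length := by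
    intro L
    induction L with
    | nil => simp
    | cons l L ih =>
      intro hl
      rw [List.flatten_cons, List.length_append, ih fun l' hl' => hl l' (List.mem_cons_of_mem _ hl'),
        (hl l List.mem_cons_self).1, List.length_cons]; ring
  obtain ⟨l0, L, rfl⟩ : ∃ l0 L', L = l0 :: L' := by
    cases L with
    | nil => simp at hL; omega
    | cons a b => exact ⟨a, b, rfl⟩
  rw [List.length_cons] at hL
  have hl0 := hseg l0 List.mem_cons_self
  have hsegL : ∀ l ∈ L, IsSeg G J l := fun l hl => hseg l (List.mem_cons_of_mem _ hl)
  have hperm : (l0 ++ W.toList ++ (L ++ J'.toList.map fun x => [x]).flatten).Perm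
      ((l0 :: L).flatten ++ (W.toList ++ J'.toList)) := by
    rw [List.flatten_append, flatten_map_singleton, List.flatten_cons]
    simp only [List.append_assoc]
    refine List.Perm.append_left _ ?_
    rw [← List.append_assoc, ← List.append_assoc]
    exact List.Perm.append_right _ List.perm_append_comm
  -- The h - s vertices of W link the first segment to s - 1 others and h + 1 - 2s single vertices.
  -- The total is 3s + (h - s) + (h + 1 - 2s) = 2h + 1.
  obtain ⟨h1, h2⟩ := isPathIn_weave (G := G) (X := W ∪ J' ∪ (l0 :: L).flatten.toFinset) (J := J)
    (s := l0) (ws := W.toList) (S := L ++ J'.toList.map fun x => [x])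
    (by simp [hW, hJ']; omega) hl0.2.1
    (fun x hx y hy => (hWJ y (by simpa using List.mem_of_mem_head? hy) x (hl0.2.2.2 x hx)).symm)
    (fun w hw x hx => hWJ w (by simpa using hw) x hx)
    (by
      intro t ht
      rcases List.mem_append.1 ht with ht | ht
      · have := hsegL t ht
        exact ⟨this.2.1, by rintro rfl; simp [IsSeg] at this, this.2.2.1, this.2.2.2⟩
      · obtain ⟨x, hx, rfl⟩ := List.mem_map.1 ht
        have := hJ'J (by simpa using hx)
        simpa using this)
    (by
      rw [hperm.nodup_iff]
      refine List.Nodup.append hnd (List.Nodup.append (Finset.nodup_toList _)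
        (Finset.nodup_toList _) ?_) ?_
      · intro x hx hx'
        exact hdisj (by simpa using hx) (hJ'J (by simpa using hx'))
      · intro x hx hx'
        rcases List.mem_append.1 hx' with h | h
        · exact hLW x hx (by simpa using h)
        · exact hLJ x hx (by simpa using h))
    (by
      intro x hx
      rw [hperm.mem_iff] at hx
      simp only [List.mem_append, Finset.mem_toList] at hx
      simp only [Finset.mem_union, List.mem_toFinset]
      tauto)
  refine h1.hasPaths ?_
  rw [h2, List.flatten_append, List.length_append, flatten_map_singleton, hfl L hsegL, hl0.1]
  simp [hW, hJ']; omega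

/-- `h` disjoint segments together with a join produce `k` disjoint paths. -/
lemma hasPaths_of_many_segs {h k : ℕ} (hh : 2 ≤ h) (hk : 2 ≤ k) {W J X : Finset V}
    (hW : W.card = (k - 1) * h) (hWJ : ∀ w ∈ W, ∀ x ∈ J, G.Adj w x) (hJX : J ⊆ X)
    (hWX : Disjoint W X) (hJ : 3 * h + k * (h + 1) ≤ J.card)
    {L : List (List V)} (hL : L.length = h) (hseg : ∀ l ∈ L, IsSeg G J l) (hnd : L.flatten.Nodup)
    (hLX : ∀ x ∈ L.flatten, x ∈ X) : HasPaths G (2 * h + 1) k (W ∪ X) := by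
  obtain ⟨k, rfl⟩ : ∃ k', k = k' + 2 := ⟨k - 2, by omega⟩
  have hWX' := Finset.disjoint_left.1 hWX
  have hW' : W.card = k * h + h := by rw [hW]; simp; ring
  rw [add_mul] at hJ
  -- Two paths share the h segments as s and h - s, and so use (h - s) + s = h vertices of W instead
  -- of 2h. The other k - 2 paths (in the original k) use h each, which is why (k-1)h vertices
  -- suffice.
  set s := h / 2 with hsdef
  have hfl : L.flatten.length = 3 * h := by
    rw [List.length_flatten]
    have : L.map List.length = List.replicate h 3 := by
      rw [List.eq_replicate_iff]
      refine ⟨by simp [hL], fun b hb => ?_⟩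
      obtain ⟨l, hl, rfl⟩ := List.mem_map.1 hb
      exact (hseg l hl).1
    rw [this]; simp; ring
  have hRc : (J \ L.flatten.toFinset).card ≥ (k + 2) * (h + 1) := by
    have h1 := Finset.le_card_sdiff L.flatten.toFinset J
    rw [List.toFinset_card_of_nodup hnd, hfl] at h1
    rw [add_mul]; omega
  rw [add_mul] at hRc
  set J0 := J \ L.flatten.toFinset with hJ0
  have hJ0J : J0 ⊆ J := Finset.sdiff_subset
  obtain ⟨J1, hJ1, hJ1c⟩ := Finset.exists_subset_card_eq (show h + 1 - 2 * s ≤ J0.card by omega)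
  obtain ⟨J2, hJ2, hJ2c⟩ := Finset.exists_subset_card_eq
    (show h + 1 - 2 * (h - s) ≤ (J0 \ J1).card by rw [Finset.card_sdiff_of_subset hJ1]; omega)
  obtain ⟨W1, hW1, hW1c⟩ := Finset.exists_subset_card_eq (show h - s ≤ W.card by omega)
  obtain ⟨W2, hW2, hW2c⟩ := Finset.exists_subset_card_eq
    (show h - (h - s) ≤ (W \ W1).card by rw [Finset.card_sdiff_of_subset hW1]; omega)
  have hsplit : (L.take s).flatten ++ (L.drop s).flatten = L.flatten := by
    rw [← List.flatten_append, List.take_append_drop]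
  have hnd' := hnd
  rw [← hsplit, List.nodup_append'] at hnd'
  have hLW : ∀ x ∈ L.flatten, x ∉ W := fun x hx hx' => hWX' hx' (hLX x hx)
  have m1 : ∀ x ∈ (L.take s).flatten, x ∈ L.flatten := fun x hx => by
    rw [← hsplit]; exact List.mem_append_left _ hx
  have m2 : ∀ x ∈ (L.drop s).flatten, x ∈ L.flatten := fun x hx => by
    rw [← hsplit]; exact List.mem_append_right _ hx
  have hLJ : ∀ x ∈ L.flatten, x ∉ J0 := fun x hx => by simp [hJ0, hx]
  have hJ2' : J2 ⊆ J0 := hJ2.trans Finset.sdiff_subset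
  have hW2' : W2 ⊆ W := hW2.trans Finset.sdiff_subset
  have p1 := hasPaths_of_segs (h := h) (s := s) (L := L.take s) (W := W1) (J := J) (J' := J1)
    (by omega) (by omega) (by rw [List.length_take]; omega)
    (fun l hl => hseg l (List.mem_of_mem_take hl)) hnd'.1 hW1c (hJ1.trans hJ0J) hJ1c
    (fun w hw x hx => hWJ w (hW1 hw) x hx) (fun x hx hx' => hLW x (m1 x hx) (hW1 hx'))
    (fun x hx hx' => hLJ x (m1 x hx) (hJ1 hx'))
  have p2 := hasPaths_of_segs (h := h) (s := h - s) (L := L.drop s) (W := W2) (J := J) (J' := J2)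
    (by omega) (by omega) (by rw [List.length_drop]; omega)
    (fun l hl => hseg l (List.mem_of_mem_drop hl)) hnd'.2.1 hW2c (hJ2'.trans hJ0J) hJ2c
    (fun w hw x hx => hWJ w (hW2' hw) x hx) (fun x hx hx' => hLW x (m2 x hx) (hW2' hx'))
    (fun x hx hx' => hLJ x (m2 x hx) (hJ2' hx'))
  have p3 := hasPaths_of_join (G := G) (h := h) (by omega) k ((W \ W1) \ W2) ((J0 \ J1) \ J2)
    (fun w hw x hx => hWJ w (Finset.sdiff_subset (Finset.sdiff_subset hw)) x
      (hJ0J (Finset.sdiff_subset (Finset.sdiff_subset hx))))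
    (by rw [Finset.card_sdiff_of_subset hW2, Finset.card_sdiff_of_subset hW1]; omega)
    (by rw [Finset.card_sdiff_of_subset hJ2, Finset.card_sdiff_of_subset hJ1]; omega)
  have hdWJ := Finset.disjoint_left.1 (disjoint_of_join hWJ)
  have hJ0X : ∀ x ∈ J0, x ∈ X := fun x hx => hJX (hJ0J hx)
  have hWJ0 : ∀ x ∈ J0, x ∉ W := fun x hx hx' => hdWJ hx' (hJ0J hx)
  have e1 : ∀ x ∈ J2, x ∉ J1 := fun x hx => (Finset.mem_sdiff.1 (hJ2 hx)).2
  have e2 : ∀ x ∈ W2, x ∉ W1 := fun x hx => (Finset.mem_sdiff.1 (hW2 hx)).2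
  have e3 : ∀ x ∈ (L.take s).flatten, x ∉ (L.drop s).flatten := fun x hx hx' => hnd'.2.2 hx hx'
  refine (((p1.add p2 ?_).add p3 ?_).of_le (by omega)).mono ?_
  · rw [Finset.disjoint_left]
    intro x hx hx'
    simp only [Finset.mem_union, List.mem_toFinset] at hx hx'
    rcases hx with (hx | hx) | hx <;> rcases hx' with (hx' | hx') | hx'
    · exact e2 x hx' hx
    · exact hWJ0 x (hJ2' hx') (hW1 hx)
    · exact hLW x (m2 x hx') (hW1 hx)
    · exact hWJ0 x (hJ1 hx) (hW2' hx')
    · exact e1 x hx' hx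
    · exact hLJ x (m2 x hx') (hJ1 hx)
    · exact hLW x (m1 x hx) (hW2' hx')
    · exact hLJ x (m1 x hx) (hJ2' hx')
    · exact e3 x hx hx'
  · rw [Finset.disjoint_left]
    intro x hx hx'
    simp only [Finset.mem_union, List.mem_toFinset, Finset.mem_sdiff] at hx hx'
    rcases hx' with ⟨⟨a1, a2⟩, a3⟩ | ⟨⟨a1, a2⟩, a3⟩
    · rcases hx with ((hx | hx) | hx) | (hx | hx) | hx
      · exact a2 hx
      · exact hWJ0 x (hJ1 hx) a1
      · exact hLW x (m1 x hx) a1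
      · exact a3 hx
      · exact hWJ0 x (hJ2' hx) a1
      · exact hLW x (m2 x hx) a1
    · rcases hx with ((hx | hx) | hx) | (hx | hx) | hx
      · exact hWJ0 x a1 (hW1 hx)
      · exact a2 hx
      · exact hLJ x (m1 x hx) a1
      · exact hWJ0 x a1 (hW2' hx)
      · exact a3 hx
      · exact hLJ x (m2 x hx) a1
  · intro x hx
    simp only [Finset.mem_union, List.mem_toFinset, Finset.mem_sdiff] at hx ⊢
    rcases hx with (((hx | hx) | hx) | (hx | hx) | hx) | hx | hx
    · exact Or.inl (hW1 hx)
    · exact Or.inr (hJ0X x (hJ1 hx))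
    · exact Or.inr (hLX x (m1 x hx))
    · exact Or.inl (hW2' hx)
    · exact Or.inr (hJ0X x (hJ2' hx))
    · exact Or.inr (hLX x (m2 x hx))
    · exact Or.inl hx.1.1
    · exact Or.inr (hJ0X x hx.1.1)

end Segments

/-! ### Finding A with many common neighbours -/

section Core

variable {V : Type*} [DecidableEq V] {G : SimpleGraph V} [DecidableRel G.Adj]

/-- Double counting of the non-adjacent pairs between `B` and `J`. -/
lemma card_le_card_common_add {B J : Finset V} :
    J.card + cnt G B J ≤ (J.filter fun y => ∀ b ∈ B, G.Adj b y).card + B.card * J.card := by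
  rw [cnt_comm]
  have h1 : ∀ y ∈ J, 1 + degIn G B y ≤ (if ∀ b ∈ B, G.Adj b y then 1 else 0) + B.card := by
    intro y _
    have h2 := degIn_le_card (G := G) B y
    split_ifs with h
    · omega
    · have : degIn G B y ≠ B.card := fun h' => h fun b hb => (degIn_eq_card.1 h' b hb).symm
      omega
  have h2 := Finset.sum_le_sum h1
  rw [Finset.sum_add_distrib, Finset.sum_add_distrib, ← Finset.card_filter] at h2
  simp only [Finset.sum_const, smul_eq_mul, mul_one] at h2
  rw [mul_comm B.card]
  exact h2

/-- The case of a graph `W ∪ X` whose part `X` has no path: `X` contains `h-1` vertices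
which together with `W` have many common neighbours. -/
lemma exists_core_of_split {h k L : ℕ} (hh : 2 ≤ h) (hk : 2 ≤ k) {W X : Finset V}
    (hWX : Disjoint W X) (hW : W.card = (k - 1) * h)
    (hno : ¬ HasPaths G (2 * h + 1) k (W ∪ X)) (hnoX : ¬ HasPaths G (2 * h + 1) 1 X)
    (hcnt : 2 * (k * h - 1) * ((W ∪ X).card - (k * h - 1)) ≤ cnt G (W ∪ X) (W ∪ X))
    (hbig : 24 * (k * h) ^ 2 + 4 * L < (W ∪ X).card) :
    ∃ A ⊆ W ∪ X, A.card = k * h - 1 ∧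
      L ≤ ((W ∪ X).filter fun y => ∀ a ∈ A, G.Adj a y).card := by
  set M := k * h with hM
  have hqM : W.card + h = M := by
    rw [hW, hM]; obtain ⟨k, rfl⟩ : ∃ k', k = k' + 1 := ⟨k - 1, by omega⟩
    simp; ring
  have hM2h : 2 * h ≤ M := Nat.mul_le_mul_right _ hk
  have hM2k : 2 * k ≤ M := by rw [hM, mul_comm]; exact Nat.mul_le_mul_left _ hh
  have hMsq : 4 * M ≤ M ^ 2 := by rw [sq]; exact Nat.mul_le_mul_right _ (by omega)
  have hhsq : 4 * h ^ 2 ≤ M ^ 2 := by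
    have := Nat.pow_le_pow_left hM2h 2; rw [mul_pow] at this; simpa using this
  have hn : (W ∪ X).card = W.card + X.card := Finset.card_union_of_disjoint hWX
  rw [hn] at hcnt hbig
  set J0 := X.filter fun x => ∀ w ∈ W, G.Adj w x with hJ0
  set I := X \ J0 with hI
  have hJ0X : J0 ⊆ X := Finset.filter_subset _ _
  have hXJI : X.card = J0.card + I.card := by
    rw [hI, Finset.card_sdiff_of_subset hJ0X]; have := Finset.card_le_card hJ0X; omega
  have hWJ : ∀ w ∈ W, ∀ x ∈ J0, G.Adj w x := fun w hw x hx => (Finset.mem_filter.1 hx).2 w hw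
  -- Each vertex of I misses a vertex of W, so the W–X pairs fall short of |W||X| by at least |I|,
  -- and X has to make up for it.
  have hXlow : 2 * (h - 1) * X.card + 2 * I.card ≤ cnt G X X + 3 * M ^ 2 := by
    have h1 := card_le_card_common_add (G := G) (B := W) (J := X)
    rw [← hJ0] at h1
    have h2 := cnt_union_self (G := G) hWX
    have h3 := cnt_le_card_mul (G := G) W W
    have h4 : W.card * W.card ≤ M ^ 2 := by rw [sq]; exact Nat.mul_le_mul (by omega) (by omega)
    have h6 : (M - 1) = W.card + (h - 1) := by omega
    have h7 : 2 * (M - 1) * (W.card + X.card - (M - 1)) + 2 * M ^ 2 ≥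
        2 * (M - 1) * X.card := by
      have : W.card + X.card - (M - 1) + M ≥ X.card := by omega
      calc 2 * (M - 1) * X.card ≤ 2 * (M - 1) * (W.card + X.card - (M - 1) + M) :=
            Nat.mul_le_mul_left _ this
        _ = 2 * (M - 1) * (W.card + X.card - (M - 1)) + 2 * ((M - 1) * M) := by ring
        _ ≤ _ := by
          have : (M - 1) * M ≤ M * M := Nat.mul_le_mul_right _ (by omega)
          rw [sq]; omega
    have h8 : 2 * (M - 1) * X.card = 2 * (W.card * X.card) + 2 * (h - 1) * X.card := by
      rw [h6]; ring
    omega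
  have hXup := cnt_le_of_no_path (G := G) (h := h) (by omega) X fun l hl =>
    Nat.le_of_lt_succ (length_lt_of_not_hasPaths hnoX hl)
  -- The lower bound is compared with the Erdős–Gallai bound (2h-1)|X|, so J0 has essentially at
  -- least half of X.
  have hIle : 2 * I.card ≤ X.card + 3 * M ^ 2 := by
    have h1 : (2 * h - 1) * X.card = 2 * (h - 1) * X.card + X.card := by
      rw [← Nat.succ_mul]; congr 1; omega
    omega
  have hJ0big : 3 * h + k * (h + 1) ≤ J0.card := by
    have : k * (h + 1) = M + k := by rw [hM]; ring
    omega
  have hnofam : ∀ F : List (List V), F.length = h → (∀ l ∈ F, IsSeg G J0 l) → F.flatten.Nodup →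
      (∀ x ∈ F.flatten, x ∈ X) → False := fun F h1 h2 h3 h4 =>
    hno (hasPaths_of_many_segs hh hk hW hWJ hJ0X hWX hJ0big h1 h2 h3 h4)
  -- With h centres, 3h is the degree that `exists_stars` requires when U consists of the centres.
  set B := X.filter fun x => 3 * h ≤ degIn G J0 x with hB
  have hBX : B ⊆ X := Finset.filter_subset _ _
  have hBc : B.card ≤ h - 1 := by
    by_contra hcon
    obtain ⟨B', hB', hBc'⟩ := Finset.exists_subset_card_eq (show h ≤ B.card by omega)
    obtain ⟨F, f1, f2, f3, f4⟩ := exists_stars (G := G) (J := J0) B' B' subset_rfl fun x hx => by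
      have := (Finset.mem_filter.1 (hB' hx)).2; omega
    exact hnofam F (by omega) f2 f3 fun x hx => by
      rcases f4 x hx with h | h
      · exact hBX (hB' h)
      · exact hJ0X h.1
  obtain ⟨R, hRc, hRX, hR⟩ : ∃ R : Finset V, R.card ≤ 3 * h ∧ R ⊆ X \ B ∧
      ∀ l, IsSeg G J0 l → l.Nodup → (∀ x ∈ l, x ∈ X \ B) → ∃ x ∈ l, x ∈ R := by
    rcases exists_family_or_hitting (fun l => IsSeg G J0 l ∧ l.Nodup ∧ ∀ x ∈ l, x ∈ X \ B)
      (c := 3) (fun l hl => ⟨hl.1.1, hl.2.1⟩) h with ⟨F, f1, f2, f3⟩ | ⟨R, r1, r2, r3⟩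
    · refine (hnofam F f1 (fun l hl => (f2 l hl).1) f3 fun x hx => ?_).elim
      obtain ⟨l, hl, hxl⟩ := List.mem_flatten.1 hx
      exact Finset.sdiff_subset ((f2 l hl).2.2 x hxl)
    · refine ⟨R, r1, fun x hx => ?_, fun l h1 h2 h3 => r3 l ⟨h1, h2, h3⟩⟩
      obtain ⟨l, hl, hxl⟩ := r2 x hx
      exact hl.2.2 x hxl
  have hBR : Disjoint B R := Finset.disjoint_of_subset_right hRX Finset.disjoint_sdiff
  set Z := B ∪ R with hZ
  have hZX : Z ⊆ X := Finset.union_subset hBX (hRX.trans Finset.sdiff_subset)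
  have hZc : Z.card ≤ 4 * h := by
    have := Finset.card_union_le B R; rw [← hZ] at this; omega
  set J1 := J0 \ Z with hJ1
  set I1 := I \ Z with hI1
  have hJ1X : J1 ⊆ X := Finset.sdiff_subset.trans hJ0X
  have hI1Z : Disjoint I1 Z := Finset.sdiff_disjoint
  have hXJ1 : X \ J1 = I1 ∪ Z := by
    ext x
    have := @hZX x
    simp only [hJ1, hI1, hI, Finset.mem_sdiff, Finset.mem_union]; tauto
  have hXc : X.card = J1.card + I1.card + Z.card := by
    have h1 : (X \ J1).card = X.card - J1.card := Finset.card_sdiff_of_subset hJ1X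
    have h2 := Finset.card_le_card hJ1X
    rw [hXJ1, Finset.card_union_of_disjoint hI1Z] at h1
    omega
  -- Two neighbours y, z in J1 would give a segment y x z that avoids B and the hitting set R.
  have hdeg1 : ∀ x ∈ X \ Z, degIn G J1 x ≤ 1 := by
    intro x hx
    rw [degIn_le_one]
    intro y hy z hz hxy hxz
    by_contra hyz
    have hy' := Finset.mem_sdiff.1 hy
    have hz' := Finset.mem_sdiff.1 hz
    have hx' := Finset.mem_sdiff.1 hx
    have hnB : ∀ u, u ∉ Z → u ∉ B := fun u hu hu' => hu (Finset.mem_union_left _ hu')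
    have hnR : ∀ u, u ∉ Z → u ∉ R := fun u hu hu' => hu (Finset.mem_union_right _ hu')
    obtain ⟨u, hu, huR⟩ := hR [y, x, z]
      ⟨rfl, by simp [hxy.symm, hxz], by simp [hy'.1], by simp [hz'.1]⟩
      (by have := hxy.ne; have := hxz.ne; simp; grind)
      (by
        intro u hu
        simp at hu
        rw [Finset.mem_sdiff]
        rcases hu with rfl | rfl | rfl
        · exact ⟨hJ0X hy'.1, hnB _ hy'.2⟩
        · exact ⟨hx'.1, hnB _ hx'.2⟩
        · exact ⟨hJ0X hz'.1, hnB _ hz'.2⟩)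
    simp at hu
    rcases hu with rfl | rfl | rfl
    · exact hnR _ hy'.2 huR
    · exact hnR _ hx'.2 huR
    · exact hnR _ hz'.2 huR
  set I' := I1.filter fun x => 0 < degIn G J1 x with hI'
  have hI'I : I' ⊆ I1 := Finset.filter_subset _ _
  have hI1X : I1 ⊆ X \ Z := Finset.sdiff_subset_sdiff Finset.sdiff_subset subset_rfl
  have c1 : cnt G J1 J1 ≤ J1.card := by
    simpa using cnt_le_mul (G := G) (X := J1) (Y := J1) (c := 1) fun x hx =>
      hdeg1 x (Finset.sdiff_subset_sdiff hJ0X subset_rfl hx)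
  have c2 : cnt G J1 I1 ≤ I'.card := by
    rw [cnt_comm, hI', Finset.card_filter]
    refine Finset.sum_le_sum fun x hx => ?_
    have := hdeg1 x (hI1X hx)
    split_ifs <;> omega
  have c3 : cnt G J1 R ≤ 9 * h ^ 2 := by
    rw [cnt_comm]
    have h1 : cnt G R J1 ≤ R.card * (3 * h) := cnt_le_mul fun x hx => by
      have h2 := Finset.mem_sdiff.1 (hRX hx)
      have h3 : ¬ 3 * h ≤ degIn G J0 x := fun h' => h2.2 (Finset.mem_filter.2 ⟨h2.1, h'⟩)
      have h4 := degIn_mono (G := G) (show J1 ⊆ J0 from Finset.sdiff_subset) x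
      omega
    have h2 : R.card * (3 * h) ≤ 3 * h * (3 * h) := Nat.mul_le_mul_right _ hRc
    have h3 : 3 * h * (3 * h) = 9 * h ^ 2 := by ring
    omega
  -- A path on 2h vertices starting in I' would extend into J1, so the refined bound saves |I'|.
  -- This offsets half of the 2|I'| pairs allowed between J1 and I1 in both directions.
  have c4 : cnt G (I1 ∪ Z) (I1 ∪ Z) + I'.card ≤ (2 * h - 1) * (I1.card + Z.card) := by
    have h1 := cnt_add_card_le (G := G) (h := h) (by omega) (I1 ∪ Z) I'
      (fun l hl => Nat.le_of_lt_succ (length_lt_of_not_hasPaths hnoX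
        (hl.mono (hXJ1 ▸ Finset.sdiff_subset))))
      (by
        intro l hl hlen x hx hxI
        obtain ⟨y, hy, hxy⟩ := degIn_pos.1 (Finset.mem_filter.1 hxI).2
        have h2 := (hl.mono (hXJ1 ▸ Finset.sdiff_subset : I1 ∪ Z ⊆ X)).cons (hJ1X hy)
          (fun h' => (Finset.mem_sdiff.1 (hXJ1 ▸ hl.mem y h' : y ∈ X \ J1)).2 hy)
          (by
            intro z hz
            have : z = x := by rw [Option.mem_def] at hx hz; rw [hx] at hz; cases hz; rfl
            subst this; exact hxy.symm)
        have h3 := length_lt_of_not_hasPaths hnoX h2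
        simp at h3; omega)
    rw [Finset.card_union_of_disjoint hI1Z] at h1
    rwa [Finset.inter_eq_right.2 (hI'I.trans Finset.subset_union_left)] at h1
  -- X needs 2(h-1) pairs per vertex. J1 has at most |J1| pairs inside itself and few with R, so the
  -- rest of its share must come from B.
  have hmain : (2 * h - 3) * J1.card ≤ 2 * cnt G B J1 + 8 * M ^ 2 := by
    have h1 := cnt_split (G := G) hJ1X
    rw [hXJ1, cnt_union_right hI1Z, hZ, cnt_union_right hBR, ← hZ, cnt_comm J1 B] at h1
    have h2 := Finset.card_le_card hI'I
    have h3 : I1.card ≤ I.card := Finset.card_le_card Finset.sdiff_subset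
    have h4 : 2 * (h - 1) * X.card = (2 * h - 3) * J1.card + J1.card + 2 * (h - 1) * I1.card
        + 2 * (h - 1) * Z.card := by
      rw [hXc]
      have : 2 * (h - 1) = (2 * h - 3) + 1 := by omega
      rw [this]; ring
    have h5 : (2 * h - 1) * (I1.card + Z.card) = 2 * (h - 1) * I1.card + I1.card +
        (2 * (h - 1) * Z.card + Z.card) := by
      have : 2 * h - 1 = 2 * (h - 1) + 1 := by omega
      rw [this]; ring
    have h6 : h ≤ h ^ 2 := Nat.le_self_pow (by norm_num) _
    omega
  have hJ1c : J0.card ≤ J1.card + Z.card := by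
    have := Finset.le_card_sdiff Z J0; rw [← hJ1] at this; omega
  have hJ1big : 8 * M ^ 2 < J1.card := by omega
  -- With at most h - 2 vertices, B would supply only (2h - 4)|J1| of the required pairs.
  have hBeq : B.card = h - 1 := by
    by_contra hne
    have h1 : cnt G B J1 ≤ (h - 2) * J1.card :=
      (cnt_le_card_mul B J1).trans (Nat.mul_le_mul_right _ (by omega))
    have h2 : (2 * h - 3) * J1.card = 2 * ((h - 2) * J1.card) + J1.card := by
      have : 2 * h - 3 = 2 * (h - 2) + 1 := by omega
      rw [this]; ring
    omega
  have hcom := card_le_card_common_add (G := G) (B := B) (J := J1)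
  set T := J1.filter fun y => ∀ b ∈ B, G.Adj b y with hT
  refine ⟨W ∪ B, Finset.union_subset_union_right hBX, ?_, ?_⟩
  · rw [Finset.card_union_of_disjoint (Finset.disjoint_of_subset_right hBX hWX)]; omega
  -- Few B–J1 pairs are missing, so at least |J1|/2 - 4M² vertices of J1 see all of B.
  · have h1 : L ≤ T.card := by
      rw [hBeq] at hcom
      have h2 : (2 * h - 3) * J1.card + J1.card = 2 * ((h - 1) * J1.card) := by
        have : 2 * (h - 1) = 2 * h - 3 + 1 := by omega
        rw [← mul_assoc, this]; ring
      omega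
    refine h1.trans (Finset.card_le_card fun y hy => ?_)
    have hy1 := Finset.mem_filter.1 hy
    refine Finset.mem_filter.2 ⟨Finset.mem_union_right _ (hJ1X hy1.1), fun a ha => ?_⟩
    rcases Finset.mem_union.1 ha with ha | ha
    · exact hWJ a ha y (Finset.sdiff_subset hy1.1)
    · exact hy1.2 a ha

/-- A dense graph without `k` disjoint paths on `2h+1` vertices contains `kh-1` vertices with many
common neighbours. -/
theorem exists_core {h k L : ℕ} (hh : 2 ≤ h) (hk : 2 ≤ k) {X : Finset V}
    (hno : ¬ HasPaths G (2 * h + 1) k X)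
    (hcnt : 2 * (k * h - 1) * (X.card - (k * h - 1)) ≤ cnt G X X)
    (hbig : 24 * (k * h) ^ 2 + 4 * L + k * errTerm h k < X.card) :
    ∃ A ⊆ X, A.card = k * h - 1 ∧ L ≤ (X.filter fun y => ∀ a ∈ A, G.Adj a y).card := by
  obtain ⟨W, hWX, hW, hnoW⟩ := exists_path_free_sdiff (by omega) (by omega) hno hcnt (by omega)
    (k - 1) (by omega)
  rw [show k - (k - 1) = 1 by omega] at hnoW
  have hWX' : W ∪ (X \ W) = X := Finset.union_sdiff_of_subset hWX
  have := exists_core_of_split (L := L) hh hk (W := W) (X := X \ W) Finset.disjoint_sdiff hW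
    (by rwa [hWX']) hnoW (by rwa [hWX']) (by rw [hWX']; omega)
  rwa [hWX'] at this

end Core

/-! ### Counting edges around A and J -/

section Finish

variable {V : Type*} [DecidableEq V] {G : SimpleGraph V} [DecidableRel G.Adj]

/-- With `kh-1` vertices `A` having many common neighbours, a path that uses fewer than `h`
vertices of `A` is completed to `k` disjoint paths. -/
lemma hasPaths_of_light_path {h k ℓ : ℕ} (hh : 1 ≤ h) (hℓ : ℓ ≤ 2 * h + 1) {Ω A J : Finset V}
    (hAΩ : A ⊆ Ω) (hJΩ : J ⊆ Ω) (hA : (k + 1) * h - 1 ≤ A.card)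
    (hAJ : ∀ a ∈ A, ∀ x ∈ J, G.Adj a x) (hJ : (k + 1) * (2 * h + 1) ≤ J.card)
    {l : List V} (hl : IsPathIn G Ω l) (hlen : ℓ ≤ l.length)
    (hlight : (A ∩ l.toFinset).card ≤ h - 1) : HasPaths G ℓ (k + 1) Ω := by
  have h1 := hl.take ℓ
  have hlc : (l.take ℓ).length = ℓ := by simp [hlen]
  set Q := (l.take ℓ).toFinset with hQ
  have hQl : Q ⊆ l.toFinset := fun x hx => by
    rw [hQ, List.mem_toFinset] at hx; exact List.mem_toFinset.2 (List.mem_of_mem_take hx)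
  have hQc : Q.card = ℓ := by rw [hQ, List.toFinset_card_of_nodup h1.nodup, hlc]
  have h2 : HasPaths G ℓ 1 Q :=
    (⟨h1.chain, h1.nodup, fun x hx => List.mem_toFinset.2 hx⟩ : IsPathIn G Q _).hasPaths hlc.ge
  have h3 : HasPaths G (2 * h + 1) k ((A \ Q) ∪ (J \ Q)) := by
    refine hasPaths_of_join hh k _ _ (fun a ha x hx => hAJ a (Finset.sdiff_subset ha) x
      (Finset.sdiff_subset hx)) ?_ ?_
    · have h4 : (A ∩ Q).card ≤ h - 1 :=
        (Finset.card_le_card (Finset.inter_subset_inter_left hQl)).trans hlight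
      have h5 := Finset.card_sdiff_add_card_inter A Q
      rw [add_mul, one_mul] at hA
      omega
    · have h4 := Finset.le_card_sdiff Q J
      have h5 : k * (h + 1) ≤ k * (2 * h + 1) := Nat.mul_le_mul_left _ (by omega)
      rw [add_mul, one_mul] at hJ
      omega
  refine (((h3.shorten hℓ).add h2 ?_)).mono ?_
  · rw [Finset.disjoint_union_left]
    exact ⟨Finset.sdiff_disjoint, Finset.sdiff_disjoint⟩
  · refine Finset.union_subset (Finset.union_subset (Finset.sdiff_subset.trans hAΩ)
      (Finset.sdiff_subset.trans hJΩ)) fun x hx => ?_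
    rw [hQ, List.mem_toFinset] at hx
    exact h1.mem x hx

/-- The number of edges of a graph without `k` disjoint paths, given `kh-1` vertices `A` whose set
`J` of common neighbours is large. -/
theorem cnt_le_of_core {h k ℓ : ℕ} (hh : 2 ≤ h) (hk : 2 ≤ k) (hℓ1 : 2 * h ≤ ℓ)
    (hℓ2 : ℓ ≤ 2 * h + 1) {Ω A J : Finset V} (hAΩ : A ⊆ Ω) (hA : A.card = k * h - 1)
    (hJdef : J = Ω.filter fun y => ∀ a ∈ A, G.Adj a y) (hJ : k * (2 * h + 1) + 3 ≤ J.card)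
    (hno : ¬ HasPaths G ℓ k Ω) :
    cnt G Ω Ω ≤ cnt G A A + 2 * (k * h - 1) * (Ω \ A).card + cnt G J J ∧ cnt G J J ≤ 2 ∧
      (ℓ = 2 * h → cnt G J J = 0) := by
  obtain ⟨k, rfl⟩ : ∃ k', k = k' + 1 := ⟨k - 1, by omega⟩
  set m := (k + 1) * h - 1 with hm
  have hmh : 2 * h - 1 ≤ m := by
    have : 2 * h ≤ (k + 1) * h := Nat.mul_le_mul_right _ hk
    omega
  set X := Ω \ A with hX
  have hXΩ : X ⊆ Ω := Finset.sdiff_subset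
  have hAJ : ∀ a ∈ A, ∀ x ∈ J, G.Adj a x := fun a ha x hx => by
    rw [hJdef] at hx; exact (Finset.mem_filter.1 hx).2 a ha
  have hJΩ : J ⊆ Ω := hJdef ▸ Finset.filter_subset _ _
  have hdAJ := Finset.disjoint_left.1 (disjoint_of_join hAJ)
  have hJX : J ⊆ X := fun x hx => Finset.mem_sdiff.2 ⟨hJΩ hx, fun h => hdAJ h hx⟩
  have hAX : Disjoint A X := Finset.disjoint_sdiff
  have hAX' := Finset.disjoint_left.1 hAX
  have hlight : ∀ l, IsPathIn G Ω l → ℓ ≤ l.length → ¬ (A ∩ l.toFinset).card ≤ h - 1 :=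
    fun l h1 h2 h3 => hno (hasPaths_of_light_path (by omega) hℓ2 hAΩ hJΩ hA.ge hAJ (by omega)
      h1 h2 h3)
  have hXno : ∀ l, IsPathIn G X l → l.length ≤ 2 * h := by
    intro l hl
    by_contra hcon
    refine hlight l (hl.mono hXΩ) (by omega) ?_
    have : A ∩ l.toFinset = ∅ := by
      rw [← Finset.disjoint_iff_inter_eq_empty, Finset.disjoint_left]
      intro x hx hx'
      exact hAX' hx (hl.mem x (List.mem_toFinset.1 hx'))
    rw [this]; simp
  -- A short path attached to A extends through only h - 1 vertices of A. Three vertices always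
  -- suffice, since 3 + 2(h-1) = 2h + 1, and two suffice when ℓ = 2h.
  have hseg : ∀ s, IsPathIn G X s → s.length ≤ 3 → ℓ ≤ s.length + 2 * (h - 1) →
      ∀ a ∈ A, (∀ x ∈ s.getLast?, G.Adj x a) → False := by
    intro s hs hs3 hsl a ha hsa
    obtain ⟨A', haA', hA', hAc⟩ := Finset.exists_subsuperset_card_eq
      (Finset.singleton_subset_iff.2 ha) (show ({a} : Finset V).card ≤ h - 1 by simp; omega)
      (show h - 1 ≤ A.card by omega)
    have hsc : s.toFinset.card ≤ 3 := (List.toFinset_card_le s).trans hs3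
    obtain ⟨l, h1, h2⟩ := exists_path_extending (A := A') (J := J \ s.toFinset) (s := s) (a := a)
      (fun b hb x hx => hAJ b (hA' hb) x (Finset.sdiff_subset hx))
      (by
        have h3 := Finset.le_card_sdiff s.toFinset J
        have h4 : 1 * (2 * h + 1) ≤ (k + 1) * (2 * h + 1) := Nat.mul_le_mul_right _ (by omega)
        omega)
      hs.chain hs.nodup (fun x hx hx' => hAX' (hA' hx') (hs.mem x hx))
      (fun x hx hx' => (Finset.mem_sdiff.1 hx').2 (List.mem_toFinset.2 hx))
      (haA' (Finset.mem_singleton_self a)) hsa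
    refine hlight l (h1.mono ?_) (by omega) ?_
    · refine Finset.union_subset (fun x hx => hXΩ (hs.mem x (List.mem_toFinset.1 hx)))
        (Finset.union_subset (hA'.trans hAΩ) (Finset.sdiff_subset.trans hJΩ))
    · rw [← hAc]
      refine Finset.card_le_card fun x hx => ?_
      rw [Finset.mem_inter, List.mem_toFinset] at hx
      have := h1.mem x hx.2
      simp only [Finset.mem_union, List.mem_toFinset] at this
      rcases this with h | h | h
      · exact (hAX' hx.1 (hs.mem x h)).elim
      · exact h
      · exact (hdAJ hx.1 (Finset.sdiff_subset h)).elim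
  set T1 := X.filter fun x => 0 < degIn G A x with hT1
  have hT1X : T1 ⊆ X := Finset.filter_subset _ _
  -- a neighbour of an attached vertex has no further neighbour
  have hpend : ∀ x ∈ T1, ∀ y ∈ X, G.Adj x y → ∀ z ∈ X, G.Adj y z → z = x := by
    intro x hx y hy hxy z hz hyz
    by_contra hne
    obtain ⟨a, ha, hxa⟩ := degIn_pos.1 (Finset.mem_filter.1 hx).2
    have h1 := hxy.ne
    have h2 := hyz.ne
    refine hseg [z, y, x] ⟨by simp [hyz.symm, hxy.symm], by simp; grind, ?_⟩ le_rfl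
      (by simp; omega) a ha (by simpa using hxa)
    intro u hu
    simp at hu
    rcases hu with rfl | rfl | rfl
    · exact hz
    · exact hy
    · exact hT1X hx
  have hdegX : ∀ y ∈ X, (∃ x ∈ T1, G.Adj y x) → degIn G X y ≤ 1 := by
    rintro y hy ⟨x, hx, hxy⟩
    rw [degIn_le_one]
    intro z hz w hw hyz hyw
    rw [hpend x hx y hy hxy.symm z hz hyz, hpend x hx y hy hxy.symm w hw hyw]
  have hdegT1 : ∀ y ∈ X, degIn G T1 y ≤ 1 := by
    intro y hy
    by_cases hex : ∃ x ∈ T1, G.Adj y x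
    · exact (degIn_mono hT1X y).trans (hdegX y hy hex)
    · push Not at hex
      rw [degIn_eq_zero.2 hex]; omega
  have hJT1 : J ⊆ T1 := by
    intro x hx
    obtain ⟨a, ha⟩ : A.Nonempty := by rw [← Finset.card_pos]; omega
    exact Finset.mem_filter.2 ⟨hJX hx, degIn_pos.2 ⟨a, ha, (hAJ a ha x hx).symm⟩⟩
  refine ⟨?_, ?_, ?_⟩
  · set T0 := X \ T1 with hT0
    set T2 := T0.filter fun y => 0 < degIn G T1 y with hT2
    have hT0X : T0 ⊆ X := Finset.sdiff_subset
    have hT2T0 : T2 ⊆ T0 := Finset.filter_subset _ _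
    have e1 : cnt G T1 T0 ≤ T2.card := by
      rw [cnt_comm, hT2, Finset.card_filter]
      refine Finset.sum_le_sum fun y hy => ?_
      have := hdegT1 y (hT0X hy)
      split_ifs <;> omega
    -- The only neighbour in X of a vertex of T2 lies in T1, so T2 is isolated in T0 and starts no
    -- path on 2h ≥ 2 vertices there.
    have e2 : cnt G T0 T0 + T2.card ≤ (2 * h - 1) * T0.card := by
      have := cnt_add_card_le (G := G) (h := h) (by omega) T0 T2
        (fun l hl => hXno l (hl.mono hT0X))
        (by
          intro l hl hlen x hx hxT
          obtain ⟨u, hu, hxu⟩ := degIn_pos.1 (Finset.mem_filter.1 hxT).2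
          match l, hl, hlen, hx with
          | y :: z :: l, hl, _, hx =>
            have hyx : y = x := by simpa using hx
            subst hyx
            have hyz : G.Adj y z := (List.isChain_cons_cons.1 hl.chain).1
            have hz := hl.mem z (by simp)
            have := hpend u hu y (hT0X (hl.mem y (by simp))) hxu.symm z (hT0X hz) hyz
            subst this
            exact (Finset.mem_sdiff.1 hz).2 hu
          | [y], _, hlen, _ => simp at hlen; omega
          | [], _, hlen, _ => simp at hlen; omega)
      rwa [Finset.inter_eq_right.2 hT2T0] at this
    have e3 : cnt G T1 T1 ≤ cnt G J J + 2 * (T1 \ J).card := by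
      rw [cnt_split hJT1]
      have h1 : cnt G (T1 \ J) T1 ≤ (T1 \ J).card * 1 :=
        cnt_le_mul fun x hx => hdegT1 x (hT1X (Finset.sdiff_subset hx))
      have h2 : cnt G (T1 \ J) T1 = cnt G J (T1 \ J) + cnt G (T1 \ J) (T1 \ J) := by
        rw [cnt_comm J, ← cnt_union_right Finset.disjoint_sdiff,
          Finset.union_sdiff_of_subset hJT1]
      omega
    -- A vertex outside J misses some vertex of A. Counted in both directions, this loss pays for
    -- the term 2|T1 \ J| in `e3`.
    have e4 : cnt G T1 A + (T1 \ J).card ≤ m * T1.card := by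
      have h1 : cnt G T1 A + (T1 \ J).card ≤ ∑ x ∈ T1, m := by
        have : T1 \ J = T1.filter fun x => x ∉ J := by ext x; simp
        rw [this, Finset.card_filter]
        unfold cnt
        rw [← Finset.sum_add_distrib]
        refine Finset.sum_le_sum fun x hx => ?_
        have h1 := degIn_le_card (G := G) A x
        split_ifs with hxJ
        · omega
        · have : degIn G A x ≠ A.card := by
            intro heq
            rw [degIn_eq_card] at heq
            apply hxJ
            rw [hJdef]
            exact Finset.mem_filter.2 ⟨hXΩ (hT1X hx), fun a ha => (heq a ha).symm⟩
          omega
      simpa [mul_comm] using h1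
    have e5 : cnt G T0 A = 0 := by
      refine Nat.le_zero.1 ((cnt_le_mul (c := 0) fun x hx => ?_).trans (by simp))
      have h1 := Finset.mem_sdiff.1 hx
      by_contra hcon
      exact h1.2 (Finset.mem_filter.2 ⟨h1.1, by omega⟩)
    have hXT : T1 ∪ T0 = X := Finset.union_sdiff_of_subset hT1X
    have e6 : cnt G A X = cnt G T1 A := by
      rw [cnt_comm, ← hXT, cnt_union_left Finset.disjoint_sdiff, e5, add_zero]
    have e7 := cnt_split (G := G) hT1X
    rw [← hT0] at e7
    have e8 := cnt_split (G := G) hAΩ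
    rw [← hX] at e8
    have e9 : T2.card ≤ T0.card := Finset.card_le_card hT2T0
    have e10 : (2 * h - 1) * T0.card + T0.card ≤ 2 * m * T0.card := by
      rw [← Nat.succ_mul]; exact Nat.mul_le_mul_right _ (by omega)
    have e11 : X.card = T1.card + T0.card := by
      rw [← hXT, Finset.card_union_of_disjoint Finset.disjoint_sdiff]
    have e12 : 2 * m * X.card = 2 * (m * T1.card) + 2 * m * T0.card := by rw [e11]; ring
    omega
  · -- two edges inside `J` would be disjoint
    by_contra hcon
    have hnotwo : ∀ y x x' y', y ∈ J → x ∈ J → x' ∈ J → y' ∈ J → G.Adj y x → G.Adj x' y' →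
        [y, x, x', y'].Nodup → False := by
      intro y x x' y' hy hx hx' hy' h1 h2 hnd
      -- Two edges, h - 1 vertices of A and h - 2 further vertices of J form a path on 4 + (h-1) +
      -- (h-2) = 2h + 1 vertices that is too light in A.
      obtain ⟨A', hA', hAc⟩ := Finset.exists_subset_card_eq (show h - 1 ≤ A.card by omega)
      have h3 : ({y, x, x', y'} : Finset V).card ≤ 4 := Finset.card_le_four
      obtain ⟨J', hJ', hJc⟩ := Finset.exists_subset_card_eq
        (show h - 2 ≤ (J \ {y, x, x', y'}).card by
          have h4 := Finset.le_card_sdiff {y, x, x', y'} J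
          have h5 : 1 * (2 * h + 1) ≤ (k + 1) * (2 * h + 1) := Nat.mul_le_mul_right _ (by omega)
          omega)
      have hJ'J : J' ⊆ J := hJ'.trans Finset.sdiff_subset
      have hJ'n : ∀ z ∈ J', z ∉ ({y, x, x', y'} : Finset V) := fun z hz =>
        (Finset.mem_sdiff.1 (hJ' hz)).2
      have hq : ∀ z ∈ [y, x, x', y'], z ∈ J := by simp [hy, hx, hx', hy']
      have hperm : ([y, x] ++ A'.toList ++ ([x', y'] :: J'.toList.map fun z => [z]).flatten).Perm
          ([y, x, x', y'] ++ (A'.toList ++ J'.toList)) := by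
        rw [List.flatten_cons, flatten_map_singleton, List.append_assoc]
        change ([y, x] ++ _).Perm ([y, x] ++ ([x', y'] ++ (A'.toList ++ J'.toList)))
        refine List.Perm.append_left [y, x] ?_
        rw [← List.append_assoc, ← List.append_assoc]
        exact List.Perm.append_right _ List.perm_append_comm
      obtain ⟨h4, h5⟩ := isPathIn_weave (G := G) (X := Ω) (J := J) (s := [y, x])
        (ws := A'.toList) (S := [x', y'] :: J'.toList.map fun z => [z])
        (by simp [hAc, hJc]; omega) (by simpa using h1)
        (by
          intro u hu w hw
          have : x = u := by simpa using hu
          subst this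
          exact (hAJ w (hA' (by simpa using List.mem_of_mem_head? hw)) x hx).symm)
        (fun w hw x hx => hAJ w (hA' (by simpa using hw)) x hx)
        (by
          intro t ht
          rcases List.mem_cons.1 ht with rfl | ht
          · simp [h2, hx', hy']
          · obtain ⟨z, hz, rfl⟩ := List.mem_map.1 ht
            have := hJ'J (by simpa using hz)
            simpa using this)
        (by
          rw [hperm.nodup_iff]
          refine List.Nodup.append hnd (List.Nodup.append (Finset.nodup_toList _)
            (Finset.nodup_toList _) ?_) ?_
          · intro z hz hz'
            exact hdAJ (hA' (by simpa using hz)) (hJ'J (by simpa using hz'))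
          · intro z hz hz'
            rcases List.mem_append.1 hz' with h | h
            · exact hdAJ (hA' (by simpa using h)) (hq z hz)
            · exact hJ'n z (by simpa using h) (by simpa using hz))
        (by
          intro z hz
          rw [hperm.mem_iff] at hz
          rcases List.mem_append.1 hz with hz | hz
          · exact hJΩ (hq z hz)
          · rcases List.mem_append.1 hz with hz | hz
            · exact hAΩ (hA' (by simpa using hz))
            · exact hJΩ (hJ'J (by simpa using hz)))
      refine hlight _ h4 (by
        rw [h5, List.flatten_cons, flatten_map_singleton]; simp [hAc, hJc]; omega) ?_
      rw [← hAc]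
      refine Finset.card_le_card fun z hz => ?_
      rw [Finset.mem_inter, List.mem_toFinset, (weave_perm _ _ _ (by simp [hAc, hJc]; omega)).mem_iff,
        hperm.mem_iff, List.mem_append, List.mem_append, Finset.mem_toList, Finset.mem_toList] at hz
      rcases hz.2 with h | h | h
      · exact (hdAJ hz.1 (hq z h)).elim
      · exact h
      · exact (hdAJ hz.1 (hJ'J h)).elim
    have hdegJ : ∀ x ∈ J, degIn G J x ≤ 1 := fun x hx =>
      (degIn_mono hJT1 x).trans (hdegT1 x (hJX hx))
    obtain ⟨x, hx, hxd⟩ : ∃ x ∈ J, 0 < degIn G J x := by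
      by_contra hnone
      push Not at hnone
      have : cnt G J J ≤ J.card * 0 := cnt_le_mul hnone
      omega
    obtain ⟨y, hy, hxy⟩ := degIn_pos.1 hxd
    have honly : ∀ x' ∈ J, ∀ y' ∈ J, G.Adj x' y' → x' ∈ ({x, y} : Finset V) := by
      intro x' hx' y' hy' hadj
      by_contra hn
      simp only [Finset.mem_insert, Finset.mem_singleton, not_or] at hn
      have hy'x : y' ≠ x := by
        rintro rfl
        exact hn.2 (degIn_le_one.1 (hdegJ _ hx) x' hx' y hy hadj.symm hxy)
      have hy'y : y' ≠ y := by
        rintro rfl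
        exact hn.1 (degIn_le_one.1 (hdegJ _ hy) x' hx' x hx hadj.symm hxy.symm)
      have := hxy.ne
      have := hadj.ne
      exact hnotwo y x x' y' hy hx hx' hy' hxy.symm hadj (by simp; grind)
    apply hcon
    have hsub : ({x, y} : Finset V) ⊆ J := by
      intro z hz; simp at hz; rcases hz with rfl | rfl <;> assumption
    have h1 := cnt_union_left (G := G) (Finset.disjoint_sdiff (s := {x, y}) (t := J)) J
    rw [Finset.union_sdiff_of_subset hsub] at h1
    have h2 : cnt G (J \ {x, y}) J ≤ (J \ {x, y}).card * 0 := cnt_le_mul fun z hz => by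
      rw [Nat.le_zero, degIn_eq_zero]
      intro w hw hzw
      exact (Finset.mem_sdiff.1 hz).2 (honly z (Finset.sdiff_subset hz) w hw hzw)
    have h3 : cnt G {x, y} J ≤ ({x, y} : Finset V).card * 1 :=
      cnt_le_mul fun z hz => hdegJ z (hsub hz)
    have h4 : ({x, y} : Finset V).card ≤ 2 := Finset.card_le_two
    omega
  · intro hℓ
    refine Nat.le_zero.1 ((cnt_le_mul (c := 0) fun x hx => ?_).trans (by simp))
    rw [Nat.le_zero, degIn_eq_zero]
    intro y hy hxy
    obtain ⟨a, ha⟩ : A.Nonempty := by rw [← Finset.card_pos]; omega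
    refine hseg [y, x] ⟨by simpa using hxy.symm, by simpa using hxy.ne', ?_⟩ (by simp)
      (by simp; omega) a ha (by simpa using (hAJ a ha x hx).symm)
    intro u hu
    simp at hu
    rcases hu with rfl | rfl
    · exact hJX hy
    · exact hJX hx

end Finish

/-! ### The upper bound -/

section Upper

lemma HasPaths.isContained {V : Type*} [DecidableEq V] {G : SimpleGraph V} {ℓ k : ℕ}
    {X : Finset V} (h : HasPaths G ℓ k X) :
    (disjointCopies k (SimpleGraph.pathGraph ℓ)).IsContained G := by
  obtain ⟨L, h1, h2, h3, -⟩ := h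
  rw [List.nodup_flatten, List.pairwise_iff_getElem] at h3
  have hl : ∀ i : Fin k, L[i].length = ℓ ∧ L[i].IsChain G.Adj := fun i => h2 _ (List.getElem_mem _)
  let f : Fin k × Fin ℓ → V := fun p => (L[p.1])[p.2]'(by rw [(hl p.1).1]; exact p.2.2)
  have hmem : ∀ p, f p ∈ L[p.1] := fun p => List.getElem_mem _
  have hinj : Function.Injective f := by
    rintro ⟨i, a⟩ ⟨j, b⟩ hij
    have hi := hmem (i, a)
    have hj := hmem (j, b)
    rw [hij] at hi
    have heq : i = j := by
      by_contra hne
      rcases lt_or_gt_of_ne hne with hlt | hlt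
      · exact h3.2 i j (by omega) (by omega) hlt hi hj
      · exact h3.2 j i (by omega) (by omega) hlt hj hi
    subst heq
    have hn : L[i].Nodup := h3.1 _ (List.getElem_mem _)
    have := (hn.getElem_inj_iff (hi := by rw [(hl i).1]; exact a.2)
      (hj := by rw [(hl i).1]; exact b.2)).1 hij
    exact Prod.ext rfl (Fin.ext this)
  refine ⟨⟨⟨f, ?_⟩, hinj⟩⟩
  rintro ⟨i, ⟨a, ha⟩⟩ ⟨j, ⟨b, hb⟩⟩ ⟨hij, hab⟩
  simp only at hij hab
  subst hij
  rw [SimpleGraph.pathGraph_adj] at hab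
  have hch := List.isChain_iff_getElem.1 (hl i).2
  simp only at hab
  rcases hab with rfl | rfl
  · exact hch a (by rw [(hl i).1]; omega)
  · exact (hch b (by rw [(hl i).1]; omega)).symm

lemma cnt_univ {V : Type*} [Fintype V] [DecidableEq V] (G : SimpleGraph V) [DecidableRel G.Adj] :
    cnt G Finset.univ Finset.univ = 2 * G.edgeSet.ncard := by
  have h := G.sum_degrees_eq_twice_card_edges
  rw [← SimpleGraph.coe_edgeFinset, Set.ncard_coe_finset, ← h]
  refine Finset.sum_congr rfl fun v _ => ?_
  rw [← SimpleGraph.card_neighborFinset_eq_degree, SimpleGraph.neighborFinset_eq_filter]; rfl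

lemma le_turanNumber {n : ℕ} {𝓕 : GraphFamily} (G : SimpleGraph (Fin n)) (hG : FamilyFree 𝓕 G) :
    (G.edgeSet.ncard : WithBot ℕ) ≤ turanNumber n 𝓕 := by
  classical
  exact Finset.le_sup (f := fun G : SimpleGraph (Fin n) => (G.edgeSet.ncard : WithBot ℕ))
    (Finset.mem_filter.2 ⟨Finset.mem_univ _, hG⟩)

lemma turanNumber_le {n : ℕ} {𝓕 : GraphFamily} {b : WithBot ℕ}
    (h : ∀ G : SimpleGraph (Fin n), FamilyFree 𝓕 G → (G.edgeSet.ncard : WithBot ℕ) ≤ b) :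
    turanNumber n 𝓕 ≤ b := by
  classical
  exact Finset.sup_le fun G hG => h G (Finset.mem_filter.1 hG).2

/-- A copy of `F - S` in `G[A]` and a placement of `S` among common neighbours of `A` combine to a
copy of `F`. -/
lemma isContained_of_placement {W V : Type*} {F : SimpleGraph W} {G : SimpleGraph V} {A J : Set V}
    (hAJ : ∀ a ∈ A, ∀ x ∈ J, G.Adj a x) {S : Set W} (g : ↥(Sᶜ) → V) (hg : Function.Injective g)
    (hgA : ∀ w, g w ∈ A) (hgadj : ∀ v w : ↥(Sᶜ), F.Adj v w → G.Adj (g v) (g w))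
    (φ : W → V) (hφ : Function.Injective φ) (hφJ : ∀ w, φ w ∈ J)
    (hφadj : ∀ s ∈ S, ∀ t ∈ S, F.Adj s t → G.Adj (φ s) (φ t)) : F.IsContained G := by
  classical
  let f : W → V := fun w => if h : w ∈ S then φ w else g ⟨w, h⟩
  have f1 : ∀ w (h : w ∈ S), f w = φ w := fun w h => dif_pos h
  have f2 : ∀ w (h : w ∉ S), f w = g ⟨w, h⟩ := fun w h => dif_neg h
  have hne : ∀ v w, g v ≠ φ w := fun v w h => (hAJ _ (hgA v) _ (hφJ w)).ne h
  refine ⟨⟨⟨f, ?_⟩, ?_⟩⟩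
  · intro v w hvw
    by_cases hv : v ∈ S <;> by_cases hw : w ∈ S
    · rw [f1 v hv, f1 w hw]; exact hφadj v hv w hw hvw
    · rw [f1 v hv, f2 w hw]; exact (hAJ _ (hgA _) _ (hφJ v)).symm
    · rw [f2 v hv, f1 w hw]; exact hAJ _ (hgA _) _ (hφJ w)
    · rw [f2 v hv, f2 w hw]; exact hgadj _ _ hvw
  · intro v w hvw
    change f v = f w at hvw
    by_cases hv : v ∈ S <;> by_cases hw : w ∈ S
    · rw [f1 v hv, f1 w hw] at hvw; exact hφ hvw
    · rw [f1 v hv, f2 w hw] at hvw; exact (hne _ _ hvw.symm).elim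
    · rw [f2 v hv, f1 w hw] at hvw; exact (hne _ _ hvw).elim
    · rw [f2 v hv, f2 w hw] at hvw; exact congrArg Subtype.val (hg hvw)

lemma not_adj_of_induce_ncard_eq_zero {W : Type*} [Finite W] {F : SimpleGraph W} {S : Set W}
    (h : (F.induce S).edgeSet.ncard = 0) {s t : W} (hs : s ∈ S) (ht : t ∈ S) : ¬ F.Adj s t := by
  intro hadj
  rw [Set.ncard_eq_zero] at h
  have : s(⟨s, hs⟩, ⟨t, ht⟩) ∈ (F.induce S).edgeSet := by simpa using hadj
  rw [h] at this; exact this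

/-- A vertex set spanning at most one edge can be placed among sufficiently many vertices which
contain an edge. -/
lemma exists_placement {W V : Type*} [Fintype W] [DecidableEq V] {F : SimpleGraph W}
    {G : SimpleGraph V} {J : Finset V} (hJ : Fintype.card W ≤ J.card) {S : Set W}
    (hS : (F.induce S).edgeSet.ncard = 0 ∨
      (F.induce S).edgeSet.ncard ≤ 1 ∧ ∃ x ∈ J, ∃ y ∈ J, G.Adj x y) :
    ∃ φ : W → V, Function.Injective φ ∧ (∀ w, φ w ∈ J) ∧
      ∀ s ∈ S, ∀ t ∈ S, F.Adj s t → G.Adj (φ s) (φ t) := by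
  classical
  obtain ⟨e⟩ : Nonempty (W ↪ J) := Function.Embedding.nonempty_of_card_le (by simpa using hJ)
  by_cases hex : ∃ u ∈ S, ∃ v ∈ S, F.Adj u v
  swap
  · push Not at hex
    exact ⟨fun w => e w, fun a b h => e.injective (Subtype.ext h), fun w => (e w).2,
      fun s hs t ht h => (hex s hs t ht h).elim⟩
  obtain ⟨u, hu, v, hv, huv⟩ := hex
  rcases hS with hS | ⟨hS, x, hx, y, hy, hxy⟩
  · exact (not_adj_of_induce_ncard_eq_zero hS hu hv huv).elim
  let x' : J := ⟨x, hx⟩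
  let y' : J := ⟨y, hy⟩
  have hxy' : x' ≠ y' := fun h => hxy.ne (congrArg Subtype.val h)
  -- Two transpositions bring the images of u and v onto the edge xy.
  let e1 : W ↪ J := e.trans (Equiv.swap (e u) x').toEmbedding
  have h1 : e1 u = x' := by simp [e1]
  have hne : x' ≠ e1 v := by rw [← h1]; exact fun h => huv.ne (e1.injective h)
  let e2 : W ↪ J := e1.trans (Equiv.swap (e1 v) y').toEmbedding
  have h2 : e2 v = y' := by simp [e2]
  have h3 : e2 u = x' := by
    simp only [e2, Function.Embedding.trans_apply, h1, Equiv.coe_toEmbedding]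
    exact Equiv.swap_apply_of_ne_of_ne hne hxy'
  refine ⟨fun w => e2 w, fun a b h => e2.injective (Subtype.ext h), fun w => (e2 w).2, ?_⟩
  intro s hs t ht hst
  rw [Set.ncard_le_one] at hS
  have h4 := hS s(⟨s, hs⟩, ⟨t, ht⟩) (by simpa using hst) s(⟨u, hu⟩, ⟨v, hv⟩) (by simpa using huv)
  simp only [Sym2.eq_iff, Subtype.mk.injEq] at h4
  rcases h4 with ⟨rfl, rfl⟩ | ⟨rfl, rfl⟩
  · simp only [h2, h3]; exact hxy
  · simp only [h2, h3]; exact hxy.symm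

lemma ncard_edgeSet_comap {V : Type*} [DecidableEq V] {G : SimpleGraph V}
    [DecidableRel G.Adj] {m : ℕ} (f : Fin m ↪ V) :
    2 * (G.comap f).edgeSet.ncard = cnt G (Finset.univ.map f) (Finset.univ.map f) := by
  classical
  rw [← cnt_univ (G.comap f)]
  unfold cnt
  rw [Finset.sum_map]
  refine Finset.sum_congr rfl fun i _ => ?_
  unfold degIn
  rw [Finset.filter_map, Finset.card_map]
  rfl

/-- If G[A] contained F - S for an admissible S, then S could be placed in J and, as A is completely
joined to J, G would contain F. -/
lemma cnt_le_turanNumber {V W : Type} [Fintype W] [DecidableEq V] {F : SimpleGraph W}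
    {G : SimpleGraph V} [DecidableRel G.Adj] (hF : F.Free G) {A J : Finset V}
    (hAJ : ∀ a ∈ A, ∀ x ∈ J, G.Adj a x) (hJ : Fintype.card W ≤ J.card) :
    ∃ e : ℕ, cnt G A A = 2 * e ∧ (e : WithBot ℕ) ≤ turanNumber A.card (familyG₁ F) ∧
      ((∃ x ∈ J, ∃ y ∈ J, G.Adj x y) → (e : WithBot ℕ) ≤ turanNumber A.card (familyG₂ F)) := by
  classical
  let f : Fin A.card ↪ V := A.equivFin.symm.toEmbedding.trans (Function.Embedding.subtype _)
  have hf : Finset.univ.map f = A := by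
    ext x
    simp only [Finset.mem_map, Finset.mem_univ, true_and, f]
    constructor
    · rintro ⟨i, rfl⟩; exact (A.equivFin.symm i).2
    · intro hx; exact ⟨A.equivFin ⟨x, hx⟩, by simp⟩
  have hfA : ∀ i, f i ∈ A := fun i => (A.equivFin.symm i).2
  have key : ∀ S : Set W, ((F.induce S).edgeSet.ncard = 0 ∨
      (F.induce S).edgeSet.ncard ≤ 1 ∧ ∃ x ∈ J, ∃ y ∈ J, G.Adj x y) →
      (F.induce Sᶜ).Free (G.comap f) := by
    rintro S hS ⟨c⟩
    obtain ⟨φ, h1, h2, h3⟩ := exists_placement hJ hS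
    exact hF (isContained_of_placement (A := A) (J := J) hAJ (fun w => f (c w))
      (fun a b h => c.injective (f.injective h)) (fun w => hfA _)
      (fun v w hvw => c.toHom.map_adj (v := v) (w := w) hvw) φ h1 h2 h3)
  refine ⟨(G.comap f).edgeSet.ncard, ?_, le_turanNumber _ ?_, fun hJe => le_turanNumber _ ?_⟩
  · rw [ncard_edgeSet_comap, hf]
  · rintro H ⟨S, hS, rfl⟩
    exact key S (Or.inl hS)
  · rintro H ⟨S, hS, rfl⟩
    exact key S (Or.inr ⟨hS, hJe⟩)

/-- The left side splits into four summands, each at most a quarter of the assumed bound on n and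
the last one strictly smaller. -/
lemma size_bound {k ℓ r h n : ℕ} (hk : 2 ≤ k) (hr : 3 ≤ r) (hh : 2 ≤ h) (h1 : 2 * h ≤ ℓ)
    (h2 : ℓ ≤ 2 * h + 1)
    (hn : 4 * k ^ 2 * ℓ ^ 2 * (k * ℓ + r) * (h + 1) * ℓ.choose h ≤ n) :
    24 * (k * h) ^ 2 + 4 * (k * (2 * h + 1) + r) + k * errTerm h k < n := by
  have hC : 1 ≤ ℓ.choose h := Nat.choose_pos (by omega)
  have hC2 : (2 * h + 1).choose h ≤ 2 * ℓ.choose h := by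
    rcases (show ℓ = 2 * h + 1 ∨ ℓ = 2 * h by omega) with rfl | rfl
    · omega
    · obtain ⟨h, rfl⟩ : ∃ h', h = h' + 1 := ⟨h - 1, by omega⟩
      rw [Nat.choose_succ_succ']
      have : (2 * (h + 1)).choose h ≤ (2 * (h + 1)).choose (h + 1) := by
        have := Nat.choose_le_centralBinom h (h + 1)
        simpa [Nat.centralBinom] using this
      omega
  set C := ℓ.choose h
  set Q := k * ℓ + r with hQ
  have hQ8 : 11 ≤ Q := by
    have : 2 * 4 ≤ k * ℓ := Nat.mul_le_mul hk (by omega)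
    omega
  have hkl : 1 ≤ k ^ 2 * ℓ ^ 2 := Nat.mul_pos (Nat.pow_pos (by omega)) (Nat.pow_pos (by omega))
  set N := k ^ 2 * ℓ ^ 2 * Q * ((h + 1) * C) with hN
  have hhC : 3 ≤ (h + 1) * C := by nlinarith
  have hN4 : 4 * N ≤ n := by
    refine le_trans (le_of_eq ?_) hn; rw [hN]; ring
  have a1 : 24 * (k * h) ^ 2 ≤ N := by
    have e1 : (2 * h) ^ 2 ≤ ℓ ^ 2 := Nat.pow_le_pow_left h1 2
    have e2 : 24 * (k * h) ^ 2 = k ^ 2 * (2 * h) ^ 2 * 6 := by ring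
    rw [e2, hN, mul_assoc (k ^ 2 * ℓ ^ 2)]
    exact Nat.mul_le_mul (Nat.mul_le_mul_left _ e1) (by nlinarith)
  have a2 : 4 * (k * (2 * h + 1) + r) ≤ N := by
    have e1 : k * (2 * h + 1) ≤ 2 * (k * ℓ) := by
      rw [mul_left_comm]; exact Nat.mul_le_mul_left _ (by omega)
    have e2 : 16 ≤ k ^ 2 * ℓ ^ 2 := by
      have e3 : 2 ^ 2 ≤ k ^ 2 := Nat.pow_le_pow_left hk 2
      have e4 : 4 ^ 2 ≤ ℓ ^ 2 := Nat.pow_le_pow_left (by omega) 2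
      nlinarith
    calc 4 * (k * (2 * h + 1) + r) ≤ 16 * Q * 1 := by omega
      _ ≤ N := by rw [hN]; exact Nat.mul_le_mul (Nat.mul_le_mul_right _ e2) (by omega)
  have a3 : k * (2 * h + 1) ^ 2 ≤ N := by
    have e1 : (2 * h + 1) ^ 2 ≤ (2 * ℓ) ^ 2 := Nat.pow_le_pow_left (by omega) 2
    have e2 : k ≤ k ^ 2 := Nat.le_self_pow (by norm_num) _
    calc k * (2 * h + 1) ^ 2 ≤ k ^ 2 * (2 * ℓ) ^ 2 := Nat.mul_le_mul e2 e1
      _ = k ^ 2 * ℓ ^ 2 * 4 * 1 := by ring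
      _ ≤ N := by rw [hN]; exact Nat.mul_le_mul (Nat.mul_le_mul_left _ (by omega)) (by omega)
  have a4 : k * (2 * ((h + 2) * (k * (2 * h + 1) * (2 * h + 1).choose h))) < N := by
    have e1 : (h + 2) * (k * (2 * h + 1) * (2 * h + 1).choose h) ≤
        (2 * (h + 1)) * (k * (2 * ℓ) * (2 * C)) :=
      Nat.mul_le_mul (by omega) (Nat.mul_le_mul (Nat.mul_le_mul_left _ (by omega)) hC2)
    calc k * (2 * ((h + 2) * (k * (2 * h + 1) * (2 * h + 1).choose h)))
        ≤ k * (2 * ((2 * (h + 1)) * (k * (2 * ℓ) * (2 * C)))) :=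
          Nat.mul_le_mul_left _ (Nat.mul_le_mul_left _ e1)
      _ = (k ^ 2 * ℓ * ((h + 1) * C)) * 16 := by ring
      _ < (k ^ 2 * ℓ * ((h + 1) * C)) * (ℓ * Q) := by
          refine Nat.mul_lt_mul_of_pos_left (by nlinarith) ?_
          have : 0 < k ^ 2 * ℓ := Nat.mul_pos (by positivity) (by omega)
          exact Nat.mul_pos this (by omega)
      _ = N := by rw [hN]; ring
  unfold errTerm
  rw [mul_add k ((2 * h + 1) ^ 2)]
  omega

/-- The edgeless graph is 𝒢₁-free: if S and its complement were both independent, F would be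
2-colourable. -/
lemma zero_le_turanNumber_familyG₁ {V : Type} {F : SimpleGraph V} [Fintype V]
    (hχ : 3 ≤ F.chromaticNumber) (m : ℕ) : (0 : WithBot ℕ) ≤ turanNumber m (familyG₁ F) := by
  classical
  have := le_turanNumber (n := m) (𝓕 := familyG₁ F) ⊥ (by
    rintro H ⟨S, hS, rfl⟩ ⟨c⟩
    have hcol : F.Colorable 2 := by
      refine ⟨SimpleGraph.Coloring.mk (fun v => if v ∈ S then (0 : Fin 2) else 1) ?_⟩
      intro v w hvw
      by_cases hv : v ∈ S <;> by_cases hw : w ∈ S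
      · exact (not_adj_of_induce_ncard_eq_zero hS hv hw hvw).elim
      · simp [hv, hw]
      · simp [hv, hw]
      · have : (F.induce Sᶜ).Adj ⟨v, hv⟩ ⟨w, hw⟩ := hvw
        exact (c.toHom.map_adj this).elim
    have h2 := hχ.trans hcol.chromaticNumber_le
    norm_num at h2)
  simpa using this

theorem turanNumber_le_formula {V : Type} [Fintype V] (F : SimpleGraph V) (r k ℓ n : ℕ)
    (hF : Fintype.card V = r) (hr : 3 ≤ r) (hχ : 3 ≤ F.chromaticNumber)
    (hk : 2 ≤ k) (hℓ : 4 ≤ ℓ)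
    (hn : 4 * k ^ 2 * ℓ ^ 2 * (k * ℓ + r) * (ℓ / 2 + 1) * ℓ.choose (ℓ / 2) ≤ n) :
    turanNumber n {⟨V, F⟩, ⟨Fin k × Fin ℓ, disjointCopies k (SimpleGraph.pathGraph ℓ)⟩} ≤
      (((n - k * (ℓ / 2) + 1) * (k * (ℓ / 2) - 1) : ℕ) : WithBot ℕ) + bConst F k ℓ := by
  classical
  set h := ℓ / 2 with hh
  set m := k * h - 1 with hm
  have hkh : 2 * 2 ≤ k * h := Nat.mul_le_mul hk (by omega)
  have hsize := size_bound hk hr (by omega) (by omega) (by omega) hn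
  have hnkh : k * h ≤ n := by
    have : k * h ≤ (k * h) ^ 2 := Nat.le_self_pow (by norm_num) _
    omega
  have hb1 : turanNumber m (familyG₁ F) ≤ bConst F k ℓ := by
    unfold bConst; split_ifs
    · exact le_max_right _ _
    · exact le_rfl
  refine turanNumber_le fun G hG => ?_
  have hGF : F.Free G := hG _ (Or.inl rfl)
  have hno : ¬ HasPaths G ℓ k Finset.univ := fun hp => hG _ (Or.inr rfl) hp.isContained
  by_cases hsmall : G.edgeSet.ncard ≤ (n - k * h + 1) * m
  · calc (G.edgeSet.ncard : WithBot ℕ) ≤ (((n - k * h + 1) * m : ℕ) : WithBot ℕ) := by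
          exact_mod_cast hsmall
      _ = (((n - k * h + 1) * m : ℕ) : WithBot ℕ) + 0 := (add_zero _).symm
      _ ≤ _ := add_le_add le_rfl ((zero_le_turanNumber_familyG₁ hχ m).trans hb1)
  have hcu := cnt_univ G
  have hnm : n - k * h + 1 = n - m := by omega
  have hun : (Finset.univ : Finset (Fin n)).card = n := by simp
  -- The summand k(2h+1) of `L` provides room for the paths. The summand r leaves room for F and
  -- covers the extra 3 in `cnt_le_of_core`.
  obtain ⟨A, -, hA, hL⟩ := exists_core (G := G) (X := Finset.univ) (h := h) (k := k)
    (L := k * (2 * h + 1) + r) (by omega) hk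
    (fun hp => hno (hp.shorten (by omega)))
    (by
      rw [hun, hcu, ← hm, ← hnm, mul_assoc, mul_comm m]
      omega)
    (by rw [hun]; exact hsize)
  obtain ⟨J, hJ, hL⟩ : ∃ J : Finset (Fin n), (∀ y, y ∈ J ↔ ∀ a ∈ A, G.Adj a y) ∧
      k * (2 * h + 1) + r ≤ J.card := ⟨_, fun y => by simp, hL⟩
  obtain ⟨c1, c2, c3⟩ := cnt_le_of_core (G := G) (h := h) (k := k) (ℓ := ℓ) (A := A) (J := J)
    (Ω := Finset.univ) (by omega) hk (by omega) (by omega) (Finset.subset_univ _) hA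
    (by ext y; simp [hJ])
    (by omega) hno
  obtain ⟨e, he, he1, he2⟩ := cnt_le_turanNumber hGF (A := A) (J := J)
    (fun a ha x hx => (hJ x).1 hx a ha) (by omega)
  rw [hA, ← hm] at he1 he2
  have hcard : (Finset.univ \ A).card = n - k * h + 1 := by
    rw [Finset.card_sdiff_of_subset (Finset.subset_univ _), hun, hA]; omega
  rw [hcu, he, hcard, ← hm] at c1
  have hmm : 2 * m * (n - k * h + 1) = 2 * ((n - k * h + 1) * m) := by ring
  by_cases hJe : cnt G J J = 0
  · have hle : G.edgeSet.ncard ≤ (n - k * h + 1) * m + e := by omega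
    calc (G.edgeSet.ncard : WithBot ℕ) ≤ (((n - k * h + 1) * m : ℕ) : WithBot ℕ) + (e : ℕ) := by
          exact_mod_cast hle
      _ ≤ _ := add_le_add le_rfl (he1.trans hb1)
  · have hodd : Odd ℓ := by
      rw [Nat.odd_iff]
      by_contra hcon
      exact hJe (c3 (by omega))
    have hex : ∃ x ∈ J, ∃ y ∈ J, G.Adj x y := by
      by_contra hcon
      push Not at hcon
      apply hJe
      refine Nat.le_zero.1 ((cnt_le_mul (c := 0) fun x hx => ?_).trans (by simp))
      exact (degIn_eq_zero.2 (hcon x hx)).le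
    have hb2 : 1 + turanNumber m (familyG₂ F) ≤ bConst F k ℓ := by
      unfold bConst; rw [if_pos hodd]; exact le_max_left _ _
    have hle : G.edgeSet.ncard ≤ (n - k * h + 1) * m + (1 + e) := by omega
    calc (G.edgeSet.ncard : WithBot ℕ)
        ≤ (((n - k * h + 1) * m : ℕ) : WithBot ℕ) + (1 + (e : ℕ)) := by exact_mod_cast hle
      _ ≤ _ := add_le_add le_rfl ((add_le_add le_rfl (he2 hex)).trans hb2)

end Upper

/-! ### The lower bound: joins -/

section Lower

/-- The join of two graphs. -/
def joinGraph {U W : Type*} (H : SimpleGraph U) (E : SimpleGraph W) : SimpleGraph (U ⊕ W) where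
  Adj
    | .inl a, .inl b => H.Adj a b
    | .inl _, .inr _ => True
    | .inr _, .inl _ => True
    | .inr a, .inr b => E.Adj a b
  symm := ⟨by
    rintro (a | a) (b | b) h
    · exact H.symm.symm _ _ h
    · trivial
    · trivial
    · exact E.symm.symm _ _ h⟩
  loopless := ⟨by
    rintro (a | a) h
    · exact H.loopless.irrefl a h
    · exact E.loopless.irrefl a h⟩

lemma ncard_edgeSet_joinGraph {m p : ℕ} (H : SimpleGraph (Fin m)) (E : SimpleGraph (Fin p)) :
    (joinGraph H E).edgeSet.ncard = p * m + (H.edgeSet.ncard + E.edgeSet.ncard) := by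
  classical
  have h1 := cnt_univ (joinGraph H E)
  let i : Fin m ↪ Fin m ⊕ Fin p := Function.Embedding.inl
  let j : Fin p ↪ Fin m ⊕ Fin p := Function.Embedding.inr
  have hu : (Finset.univ : Finset (Fin m ⊕ Fin p)) = Finset.univ.map i ∪ Finset.univ.map j := by
    ext x; rcases x with x | x <;> simp [i, j]
  have hd : Disjoint (Finset.univ.map i) (Finset.univ.map j) := by
    rw [Finset.disjoint_left]; rintro (x | x) <;> simp [i, j]
  have h2 := ncard_edgeSet_comap (G := joinGraph H E) i
  have h3 := ncard_edgeSet_comap (G := joinGraph H E) j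
  have h4 : (joinGraph H E).comap i = H := by ext a b; rfl
  have h5 : (joinGraph H E).comap j = E := by ext a b; rfl
  rw [h4] at h2
  rw [h5] at h3
  have h6 : cnt (joinGraph H E) (Finset.univ.map i) (Finset.univ.map j) = m * p := by
    have : ∀ x ∈ Finset.univ.map i, degIn (joinGraph H E) (Finset.univ.map j) x = p := by
      intro x hx
      have : degIn (joinGraph H E) (Finset.univ.map j) x = (Finset.univ.map j).card := by
        rw [degIn_eq_card]
        intro y hy
        simp only [Finset.mem_map, Finset.mem_univ, true_and] at hx hy
        obtain ⟨a, rfl⟩ := hx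
        obtain ⟨b, rfl⟩ := hy
        trivial
      simpa using this
    unfold cnt
    rw [Finset.sum_congr rfl this]; simp
  rw [hu, cnt_union_self hd, ← h2, ← h3, h6] at h1
  rw [mul_comm p m]
  omega

lemma card_filter_of_pairs {P : ℕ → Prop} [DecidablePred P] {h ℓ o : ℕ} (ho : 2 * h + o ≤ ℓ)
    (hP : ∀ i < h, P (2 * i + o) ∨ P (2 * i + o + 1)) :
    h ≤ ((Finset.range ℓ).filter P).card := by
  let g : ℕ → ℕ := fun i => if P (2 * i + o) then 2 * i + o else 2 * i + o + 1
  have hg : ∀ i, g i = 2 * i + o ∨ g i = 2 * i + o + 1 := fun i => by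
    simp only [g]; split_ifs <;> simp
  conv_lhs => rw [← Finset.card_range h]
  refine Finset.card_le_card_of_injOn g ?_ ?_
  · intro i hi
    have hi' : i < h := by simpa using hi
    simp only [Finset.coe_filter, Finset.mem_range, Set.mem_ofPred_eq]
    refine ⟨by have := hg i; omega, ?_⟩
    by_cases hp : P (2 * i + o)
    · simp only [g, if_pos hp]; exact hp
    · simp only [g, if_neg hp]; exact (hP i hi').resolve_left hp
  · intro i _ j _ hij
    have := hg i; have := hg j; omega

/-- A path in the join of `H` with a graph with at most one edge has many vertices in `H`. -/
lemma le_card_left_of_path {m p h ℓ : ℕ} {H : SimpleGraph (Fin m)} {E : SimpleGraph (Fin p)}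
    (hE : E.edgeSet.ncard = 0 ∧ 2 * h ≤ ℓ ∨ E.edgeSet.ncard ≤ 1 ∧ 2 * h + 1 ≤ ℓ)
    {c : Fin ℓ → Fin m ⊕ Fin p} (hc : Function.Injective c)
    (hadj : ∀ t (ht : t + 1 < ℓ),
      (joinGraph H E).Adj (c ⟨t, by omega⟩) (c ⟨t + 1, ht⟩)) :
    h ≤ (Finset.univ.filter fun t => (c t).isLeft = true).card := by
  classical
  let P : ℕ → Prop := fun t => ∃ ht : t < ℓ, (c ⟨t, ht⟩).isLeft = true
  have hcard : ((Finset.range ℓ).filter P).card ≤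
      (Finset.univ.filter fun t => (c t).isLeft = true).card := by
    refine (Finset.card_le_card (t := (Finset.univ.filter fun t : Fin ℓ =>
      (c t).isLeft = true).image Fin.val) ?_).trans Finset.card_image_le
    intro t ht
    obtain ⟨-, ht', h⟩ := Finset.mem_filter.1 ht
    exact Finset.mem_image.2 ⟨⟨t, ht'⟩, Finset.mem_filter.2 ⟨Finset.mem_univ _, h⟩, rfl⟩
  refine le_trans ?_ hcard
  have hedge : ∀ t (ht : t + 1 < ℓ), ¬ (P t ∨ P (t + 1)) →
      ∃ a b, E.Adj a b ∧ c ⟨t, by omega⟩ = Sum.inr a ∧ c ⟨t + 1, ht⟩ = Sum.inr b := by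
    intro t ht hn
    push Not at hn
    have h1 := hadj t ht
    have h2 : ¬ (c ⟨t, by omega⟩).isLeft = true := fun h => hn.1 ⟨_, h⟩
    have h3 : ¬ (c ⟨t + 1, ht⟩).isLeft = true := fun h => hn.2 ⟨_, h⟩
    rcases hx : c ⟨t, by omega⟩ with a | a
    · rw [hx] at h2; simp at h2
    rcases hy : c ⟨t + 1, ht⟩ with b | b
    · rw [hy] at h3; simp at h3
    rw [hx, hy] at h1
    exact ⟨a, b, h1, rfl, rfl⟩
  by_cases hall : ∀ i < h, P (2 * i + 0) ∨ P (2 * i + 0 + 1)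
  · exact card_filter_of_pairs (by omega) hall
  push Not at hall
  obtain ⟨i, hi, hn⟩ := hall
  obtain ⟨a, b, hab, ha, hb⟩ := hedge (2 * i + 0) (by omega) (by tauto)
  rcases hE with ⟨hE, -⟩ | ⟨hE, hℓ⟩
  · rw [Set.ncard_eq_zero] at hE
    have : s(a, b) ∈ E.edgeSet := hab
    rw [hE] at this; exact this.elim
  -- If some pair of positions (2i, 2i+1) is the edge of E, the pairing is shifted by one, which
  -- needs the odd vertex. A path cannot use that edge again.
  refine card_filter_of_pairs (o := 1) hℓ ?_
  intro j hj
  by_contra hn'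
  obtain ⟨a', b', hab', ha', hb'⟩ := hedge (2 * j + 1) (by omega) hn'
  rw [Set.ncard_le_one] at hE
  have := hE s(a, b) hab s(a', b') hab'
  rw [Sym2.eq_iff] at this
  rcases this with ⟨rfl, rfl⟩ | ⟨rfl, rfl⟩
  · have := congrArg Fin.val (hc (ha.trans ha'.symm)); simp at this; omega
  · have h1 := congrArg Fin.val (hc (ha.trans hb'.symm))
    have h2 := congrArg Fin.val (hc (hb.trans ha'.symm))
    simp at h1 h2; omega

lemma not_disjointCopies_isContained_joinGraph {m p h ℓ k : ℕ} {H : SimpleGraph (Fin m)}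
    {E : SimpleGraph (Fin p)} (hm : m < k * h)
    (hE : E.edgeSet.ncard = 0 ∧ 2 * h ≤ ℓ ∨ E.edgeSet.ncard ≤ 1 ∧ 2 * h + 1 ≤ ℓ) :
    ¬ (disjointCopies k (SimpleGraph.pathGraph ℓ)).IsContained (joinGraph H E) := by
  classical
  rintro ⟨c⟩
  have h1 : ∀ i : Fin k, h ≤ (Finset.univ.filter fun t : Fin ℓ => (c (i, t)).isLeft = true).card := by
    intro i
    refine le_card_left_of_path (H := H) (E := E) hE (c := fun t => c (i, t)) (fun a b hab => ?_) ?_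
    · exact congrArg Prod.snd (c.injective hab)
    · intro t ht
      exact c.toHom.map_adj ⟨rfl, SimpleGraph.pathGraph_adj.2 (Or.inl rfl)⟩
  have h2 : k * h ≤ (Finset.univ.filter fun q : Fin k × Fin ℓ => (c q).isLeft = true).card := by
    rw [Finset.card_filter, Fintype.sum_prod_type]
    have := Finset.card_nsmul_le_sum (Finset.univ : Finset (Fin k))
      (fun i => (Finset.univ.filter fun t : Fin ℓ => (c (i, t)).isLeft = true).card) h
      fun i _ => h1 i
    simp only [Finset.card_filter, Finset.card_univ, Fintype.card_fin, smul_eq_mul] at this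
    exact this
  have h3 : (Finset.univ.filter fun q : Fin k × Fin ℓ => (c q).isLeft = true).card ≤
      ((Finset.univ : Finset (Fin m)).map (Function.Embedding.inl (β := Fin p))).card := by
    refine Finset.card_le_card_of_injOn c ?_ c.injective.injOn
    intro q hq
    have hq' : (c q).isLeft = true := by simpa using hq
    rw [Sum.isLeft_iff] at hq'
    obtain ⟨a, ha⟩ := hq'
    exact Finset.mem_coe.2 (Finset.mem_map.2 ⟨a, Finset.mem_univ _, ha.symm⟩)
  rw [Finset.card_map, Finset.card_univ, Fintype.card_fin] at h3
  omega

/-- Let S be the set of vertices of F mapped into E. Then F[S] embeds in E, so it has at most s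
edges, while F - S embeds in H. -/
lemma free_joinGraph {V : Type} [Finite V] {F : SimpleGraph V} {m p s : ℕ}
    {H : SimpleGraph (Fin m)} {E : SimpleGraph (Fin p)} (hE : E.edgeSet.ncard ≤ s)
    (hH : ∀ S : Set V, (F.induce S).edgeSet.ncard ≤ s → (F.induce Sᶜ).Free H) :
    F.Free (joinGraph H E) := by
  rintro ⟨c⟩
  let S : Set V := {v | (c v).isRight = true}
  have hR : ∀ v : S, ∃ b, c v = Sum.inr b := fun v => Sum.isRight_iff.1 v.2
  have hL : ∀ v : ↥(Sᶜ), ∃ a, c v = Sum.inl a := fun v =>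
    Sum.isLeft_iff.1 (by have : ¬ (c v).isRight = true := v.2; simpa using this)
  choose f hf using hR
  choose g hg using hL
  refine hH S ?_ ⟨⟨⟨g, ?_⟩, ?_⟩⟩
  · refine le_trans (Set.ncard_le_ncard_of_injOn (Sym2.map f) ?_ ?_ (Set.toFinite _)) hE
    · intro e
      induction e with
      | _ v w =>
        intro he
        have h1 := c.toHom.map_adj (v := v) (w := w) he
        change (joinGraph H E).Adj (c v) (c w) at h1
        rw [hf, hf] at h1
        exact h1
    · refine Set.injOn_of_injective (Sym2.map.injective fun v w hvw => ?_)
      exact Subtype.ext (c.injective ((hf v).trans ((congrArg Sum.inr hvw).trans (hf w).symm)))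
  · intro v w hvw
    have h1 := c.toHom.map_adj (v := v) (w := w) hvw
    change (joinGraph H E).Adj (c v) (c w) at h1
    rw [hg, hg] at h1
    exact h1
  · intro v w hvw
    exact Subtype.ext (c.injective ((hg v).trans ((congrArg Sum.inl hvw).trans (hg w).symm)))

lemma turanNumber_eq_bot_or (n : ℕ) (𝓕 : GraphFamily) : turanNumber n 𝓕 = ⊥ ∨
    ∃ G : SimpleGraph (Fin n), FamilyFree 𝓕 G ∧ turanNumber n 𝓕 = (G.edgeSet.ncard : WithBot ℕ) := by
  classical
  unfold turanNumber
  rcases (Finset.univ.filter fun G : SimpleGraph (Fin n) => FamilyFree 𝓕 G).eq_empty_or_nonempty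
    with h | h
  · left; rw [h, Finset.sup_empty]
  · right
    obtain ⟨G, hG, h⟩ := Finset.exists_mem_eq_sup _ h
      fun G : SimpleGraph (Fin n) => (G.edgeSet.ncard : WithBot ℕ)
    exact ⟨G, (Finset.mem_filter.1 hG).2, h⟩

lemma le_turanNumber_of_joinGraph {m p : ℕ} {𝓕 : GraphFamily} {H : SimpleGraph (Fin m)}
    {E : SimpleGraph (Fin p)} (hfree : FamilyFree 𝓕 (joinGraph H E)) :
    ((p * m + (H.edgeSet.ncard + E.edgeSet.ncard) : ℕ) : WithBot ℕ) ≤ turanNumber (m + p) 𝓕 := by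
  classical
  let f : Fin (m + p) ↪ Fin m ⊕ Fin p := finSumFinEquiv.symm.toEmbedding
  have h1 := le_turanNumber (𝓕 := 𝓕) ((joinGraph H E).comap f) (by
    rintro K hK ⟨c⟩
    exact hfree K hK ⟨⟨⟨fun v => f (c v), fun {v w} h => c.toHom.map_adj h⟩,
      fun a b h => c.injective (f.injective h)⟩⟩)
  have h2 := ncard_edgeSet_comap (G := joinGraph H E) f
  have h3 : Finset.univ.map f = Finset.univ := Finset.map_univ_equiv finSumFinEquiv.symm
  rw [h3, cnt_univ, ncard_edgeSet_joinGraph] at h2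
  rwa [Nat.eq_of_mul_eq_mul_left (by norm_num) h2] at h1

theorem formula_le_turanNumber {V : Type} [Fintype V] (F : SimpleGraph V) (k ℓ n : ℕ)
    (hk : 2 ≤ k) (hℓ : 4 ≤ ℓ) (hn : k * (ℓ / 2) + 1 ≤ n) :
    (((n - k * (ℓ / 2) + 1) * (k * (ℓ / 2) - 1) : ℕ) : WithBot ℕ) + bConst F k ℓ ≤
      turanNumber n {⟨V, F⟩, ⟨Fin k × Fin ℓ, disjointCopies k (SimpleGraph.pathGraph ℓ)⟩} := by
  classical
  set h := ℓ / 2 with hh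
  have hkh : 2 * 2 ≤ k * h := Nat.mul_le_mul hk (by omega)
  unfold bConst
  rw [← hh]
  obtain ⟨p, hp⟩ : ∃ p, n - k * h + 1 = p := ⟨_, rfl⟩
  have hm : k * h - 1 < k * h := by omega
  have hnmp : n = (k * h - 1) + p := by omega
  rw [hp]
  have hp2 : 2 ≤ p := by omega
  clear hp
  generalize k * h - 1 = m at *
  subst hnmp
  have key : ∀ (H : SimpleGraph (Fin m)) (E : SimpleGraph (Fin p)), F.Free (joinGraph H E) →
      (E.edgeSet.ncard = 0 ∧ 2 * h ≤ ℓ ∨ E.edgeSet.ncard ≤ 1 ∧ 2 * h + 1 ≤ ℓ) →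
      ((p * m + (H.edgeSet.ncard + E.edgeSet.ncard) : ℕ) : WithBot ℕ) ≤ turanNumber (m + p)
        {⟨V, F⟩, ⟨Fin k × Fin ℓ, disjointCopies k (SimpleGraph.pathGraph ℓ)⟩} := by
    intro H E hF hE
    refine le_turanNumber_of_joinGraph ?_
    rintro K (rfl | rfl)
    · exact hF
    · exact not_disjointCopies_isContained_joinGraph hm hE
  have g1 : ((p * m : ℕ) : WithBot ℕ) + turanNumber m (familyG₁ F) ≤ turanNumber (m + p)
        {⟨V, F⟩, ⟨Fin k × Fin ℓ, disjointCopies k (SimpleGraph.pathGraph ℓ)⟩} := by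
    rcases turanNumber_eq_bot_or m (familyG₁ F) with hb | ⟨H, hH, hb⟩
    -- With no 𝒢₁-free graph on m vertices the left side is -∞.
    · rw [hb, WithBot.add_bot]; exact bot_le
    rw [hb]
    have hE : (⊥ : SimpleGraph (Fin p)).edgeSet.ncard = 0 := by simp
    have := key H ⊥ (free_joinGraph hE.le fun S hS => hH _ ⟨S, Nat.le_zero.1 hS, rfl⟩)
      (Or.inl ⟨hE, by omega⟩)
    rw [hE, add_zero] at this
    exact_mod_cast this
  split_ifs with hodd
  · rcases le_total (1 + turanNumber m (familyG₂ F)) (turanNumber m (familyG₁ F)) with hle | hle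
    · rw [max_eq_right hle]; exact g1
    rw [max_eq_left hle]
    rcases turanNumber_eq_bot_or m (familyG₂ F) with hb | ⟨H, hH, hb⟩
    · rw [hb, WithBot.add_bot, WithBot.add_bot]; exact bot_le
    rw [hb]
    let E : SimpleGraph (Fin p) := SimpleGraph.edge ⟨0, by omega⟩ ⟨1, by omega⟩
    have hE : E.edgeSet.ncard = 1 := by
      simp only [E]
      rw [SimpleGraph.edgeSet_edge_of_ne (by simp)]; simp
    have hodd' := Nat.odd_iff.1 hodd
    have := key H E (free_joinGraph hE.le fun S hS => hH _ ⟨S, hS, rfl⟩)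
      (Or.inr ⟨hE.le, by omega⟩)
    rw [hE, add_comm H.edgeSet.ncard] at this
    exact_mod_cast this
  · exact g1

end Lower

end PathTuran

theorem mainTheorem3 {V : Type} [Fintype V] (F : SimpleGraph V) (r k ℓ n : ℕ)
    (hF : Fintype.card V = r) (hr : 3 ≤ r)
    (hχ : 3 ≤ F.chromaticNumber) (hβ : 2 ≤ edgeControlNumber F)
    (hk : 2 ≤ k) (hℓ : 4 ≤ ℓ)
    (hn : 4 * k ^ 2 * ℓ ^ 2 * (k * ℓ + r) * (ℓ / 2 + 1) * ℓ.choose (ℓ / 2) ≤ n) :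
    turanNumber n {⟨V, F⟩, ⟨Fin k × Fin ℓ, disjointCopies k (SimpleGraph.pathGraph ℓ)⟩} =
      (((n - k * (ℓ / 2) + 1) * (k * (ℓ / 2) - 1) : ℕ) : WithBot ℕ) + bConst F k ℓ := by
  refine le_antisymm (PathTuran.turanNumber_le_formula F r k ℓ n hF hr hχ hk hℓ hn)
    (PathTuran.formula_le_turanNumber F k ℓ n hk hℓ ?_)
  have h1 := PathTuran.size_bound hk hr (by omega) (by omega) (by omega) hn
  have h2 : k * (ℓ / 2) ≤ (k * (ℓ / 2)) ^ 2 := Nat.le_self_pow (by norm_num) _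
  omega
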